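/- There are absolute constants $C>0$ and $\mathcal C>0$ with the following property. Let $1\le s\le n$ and let $f:\mathbb R^n\to\mathbb R$ be twice continuously differentiable with $L$-Lipschitz gradient and $M$-Lipschitz Hessian (in operator norm), i.e. $\|\nabla f(x)-\nabla f(y)\|\le L\|x-y\|$ and $\|\nabla^2 f(x)-\nabla^2 f(y)\|\le M\|x-y\|$ for all $x,y$. Let $\delta\ge 0$ and $\Delta>0$, and let $(x_k)_{k\ge 0}$ be generated by the Random Subspace Homogenized Trust Region method (RSHTR): starting from $x_0$ in "global mode" with parameter $\delta_0=\delta$, at iteration $k$ 1. draw a random matrix $P_k\in\mathbb R^{s\times n}$ with independent $\mathcal N(0,1/s)$ entries, independent of everything before iteration $k$; 2. with $\tilde g_k=P_k\nabla f(x_k)$ and $\tilde H_k=P_k\nabla^2 f(x_k)P_k^\top$, take a minimizer $[\tilde v_k;t_k]\in\mathbb R^{s+1}$ of $$\begin{bmatrix}\tilde v\\ t\end{bmatrix}^{\top}\begin{bmatrix}\tilde H_k&\tilde g_k\\ \tilde g_k^\top&-\delta_k\end{bmatrix}\begin{bmatrix}\tilde v\\ t\end{bmatrix}\quad\text{over }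 \|[\tilde v;t]\|\le 1;$$ 3. put $d_k=P_k^\top\tilde v_k/t_k$ if $t_k\ne 0$ and $d_k=P_k^\top\tilde v_k$ otherwise; 4. if the method is in global mode and $\|d_k\|>\Delta$, set $x_{k+1}=x_k+(\Delta/\|d_k\|)d_k$, and stay in global mode with $\delta_{k+1}=\delta$; otherwise set $x_{k+1}=x_k+d_k$, leave global mode for good and set $\delta_j=0$ for all $j>k$. Suppose that $x_k$ converges almost surely to a point $\bar x$ with $\nabla f(\bar x)=0$ and $\bar H:=\nabla^2 f(\bar x)\succ 0$. Write $\|x\|_{\bar H}=\sqrt{x^\top\bar H x}$ and $\kappa(\bar H)=\lambda_{\max}(\bar H)/\lambda_{\min}(\bar H)$. Then there is $k_0$ such that for all $k\ge k_0$ $$\Pr\left[\|x_{k+1}-\bar x\|_{\bar H}\le\sqrt{1-\frac{1}{4\,\kappa(\bar H)\,(\sqrt{n/s}+\mathcal C)^2}}\;\|x_k-\bar x\|_{\bar H}\right]\ \ge\ 1-2\exp\left(-\tfrac{C}{4}s\right)-8\exp(-s).$$ -/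

import Mathlib

open MeasureTheory ProbabilityTheory Filter Topology
open scoped Matrix Gradient

noncomputable section

/-- The Hessian of `f` at `x`, as a linear operator on Euclidean space: the derivative of `∇ f`.
Its norm is the operator (spectral) norm. -/
def hessOp {n : ℕ} (f : EuclideanSpace ℝ (Fin n) → ℝ) (x : EuclideanSpace ℝ (Fin n)) :
    EuclideanSpace ℝ (Fin n) →L[ℝ] EuclideanSpace ℝ (Fin n) :=
  fderiv ℝ (∇ f) x

/-- The Hessian of `f` at `x`, as a matrix in the standard basis. -/
def hessMat {n : ℕ} (f : EuclideanSpace ℝ (Fin n) → ℝ) (x : EuclideanSpace ℝ (Fin n)) :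
    Matrix (Fin n) (Fin n) ℝ :=
  Matrix.of fun i j => hessOp f x (EuclideanSpace.single j 1) i

/-- The largest eigenvalue of a real symmetric matrix. -/
def lambdaMax {n : ℕ} (A : Matrix (Fin n) (Fin n) ℝ) : ℝ := sSup (spectrum ℝ A)

/-- The smallest eigenvalue of a real symmetric matrix. -/
def lambdaMin {n : ℕ} (A : Matrix (Fin n) (Fin n) ℝ) : ℝ := sInf (spectrum ℝ A)

/-- The condition number `κ(A) = λ_max(A) / λ_min(A)` of a symmetric positive definite matrix. -/
def condNumber {n : ℕ} (A : Matrix (Fin n) (Fin n) ℝ) : ℝ := lambdaMax A / lambdaMin A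

/-- The norm `‖x‖_A = √(xᵀ A x)` given by a symmetric positive definite matrix `A`. -/
def matNorm {n : ℕ} (A : Matrix (Fin n) (Fin n) ℝ) (x : EuclideanSpace ℝ (Fin n)) : ℝ :=
  √(x.ofLp ⬝ᵥ A *ᵥ x.ofLp)

/-- Lipschitz gradient (constant `L`) and Lipschitz Hessian (constant `M`) for a `C²` function. -/
structure HasLipschitzGradHess {n : ℕ} (f : EuclideanSpace ℝ (Fin n) → ℝ) (L M : ℝ) : Prop where
  contDiff : ContDiff ℝ 2 f
  grad_lipschitz : ∀ x y, ‖∇ f x - ∇ f y‖ ≤ L * ‖x - y‖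
  hess_lipschitz : ∀ x y, ‖hessOp f x - hessOp f y‖ ≤ M * ‖x - y‖

/-- The list of the entries of an `s × n` matrix. -/
def matEntries {s n : ℕ} (A : Matrix (Fin s) (Fin n) ℝ) : Fin s × Fin n → ℝ :=
  fun p => A p.1 p.2

/-- `P` is a random `s × n` matrix with independent `N(0, 1/s)` entries. -/
structure IsGaussianMatrix {Ω : Type*} [MeasurableSpace Ω] (μ : Measure Ω) {s n : ℕ}
    (P : Ω → Matrix (Fin s) (Fin n) ℝ) : Prop where
  indep : iIndepFun (fun (p : Fin s × Fin n) (ω : Ω) => P ω p.1 p.2) μ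
  law : ∀ i j, HasLaw (fun ω => P ω i j) (gaussianReal 0 ((s : NNReal)⁻¹)) μ

/-- The symmetric matrix `[H, g; gᵀ, -δ]` of the homogenized quadratic model. -/
def homMat {s : ℕ} (H : Matrix (Fin s) (Fin s) ℝ) (g : Fin s → ℝ) (δ : ℝ) :
    Matrix (Fin s ⊕ Unit) (Fin s ⊕ Unit) ℝ :=
  Matrix.fromBlocks H (Matrix.of fun i _ => g i) (Matrix.of fun _ j => g j)
    (Matrix.of fun _ _ => -δ)

/-- The vector `[v; t]`. -/
def homVec {s : ℕ} (v : Fin s → ℝ) (t : ℝ) : Fin s ⊕ Unit → ℝ := Sum.elim v (fun _ => t)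

/-- `[v; t]` minimizes the quadratic form of `[H, g; gᵀ, -δ]` over the closed Euclidean unit ball
of `ℝ^(s+1)`. -/
def IsSubproblemSol {s : ℕ} (H : Matrix (Fin s) (Fin s) ℝ) (g : Fin s → ℝ) (δ : ℝ)
    (v : Fin s → ℝ) (t : ℝ) : Prop :=
  homVec v t ∈ {u : Fin s ⊕ Unit → ℝ | u ⬝ᵥ u ≤ 1} ∧
    IsMinOn (fun u : Fin s ⊕ Unit → ℝ => u ⬝ᵥ homMat H g δ *ᵥ u) {u | u ⬝ᵥ u ≤ 1} (homVec v t)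

/-- The direction: `Pᵀ v / t` if `t ≠ 0`, and `Pᵀ v` otherwise. -/
def rshtrDir {s n : ℕ} (P : Matrix (Fin s) (Fin n) ℝ) (v : Fin s → ℝ) (t : ℝ) :
    EuclideanSpace ℝ (Fin n) :=
  if t ≠ 0 then WithLp.toLp 2 (t⁻¹ • (Pᵀ *ᵥ v)) else WithLp.toLp 2 (Pᵀ *ᵥ v)

/-- The update of the iterate: in global mode a direction longer than `Δ` is cut to length `Δ`;
otherwise the full direction is taken. -/
def rshtrStep {n : ℕ} (Δ : ℝ) (globalMode : Bool) (x d : EuclideanSpace ℝ (Fin n)) :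
    EuclideanSpace ℝ (Fin n) :=
  if globalMode = true ∧ Δ < ‖d‖ then x + (Δ / ‖d‖) • d else x + d

/-- `x` is the sequence of iterates of a run of RSHTR on `f` with parameters `δ`, `Δ`, which is
continued with `δ` reset to `0` and with full steps once the stopping test `‖d_k‖ ≤ Δ` has
succeeded. `P k` are the random matrices, `(v k, t k)` the computed optimal solutions of the
subproblems, `gm k` tells whether iteration `k` is still in global mode, and `ℱ k` is the
information available before iteration `k`, from which the fresh matrix `P k` is independent. -/
structure IsRSHTRRun {n s : ℕ} (f : EuclideanSpace ℝ (Fin n) → ℝ) (δ Δ : ℝ)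
    {Ω : Type*} [mΩ : MeasurableSpace Ω] (μ : Measure Ω) (ℱ : Filtration ℕ mΩ)
    (P : ℕ → Ω → Matrix (Fin s) (Fin n) ℝ) (v : ℕ → Ω → Fin s → ℝ) (t : ℕ → Ω → ℝ)
    (gm : ℕ → Ω → Bool) (x : ℕ → Ω → EuclideanSpace ℝ (Fin n)) : Prop where
  gaussian : ∀ k, IsGaussianMatrix μ (P k)
  indep_past : ∀ k,
    Indep (MeasurableSpace.comap (fun ω => matEntries (P k ω)) inferInstance) (ℱ k) μ
  measurable_mat : ∀ k, Measurable[ℱ (k + 1)] (fun ω => matEntries (P k ω))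
  measurable_v : ∀ k, Measurable[ℱ (k + 1)] (v k)
  measurable_t : ∀ k, Measurable[ℱ (k + 1)] (t k)
  measurable_init : Measurable[ℱ 0] (x 0)
  subproblem : ∀ k ω, IsSubproblemSol (P k ω * hessMat f (x k ω) * (P k ω)ᵀ)
    (P k ω *ᵥ (∇ f (x k ω)).ofLp) (if gm k ω = true then δ else 0) (v k ω) (t k ω)
  mode_zero : ∀ ω, gm 0 ω = true
  mode_succ : ∀ k ω,
    gm (k + 1) ω = true ↔ gm k ω = true ∧ Δ < ‖rshtrDir (P k ω) (v k ω) (t k ω)‖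
  step : ∀ k ω,
    x (k + 1) ω = rshtrStep Δ (gm k ω) (x k ω) (rshtrDir (P k ω) (v k ω) (t k ω))

end

/-! Write `g = ∇f(x_k)`, `e = x_k - xbar`, `A` for the Hessian at `xbar`, with extreme eigenvalues
`m ≤ Λ`. Once the method is in local mode (`δ_k = 0`) and `x_k` is near `xbar`, the contraction is
deterministic, given two properties of `P = P_k` relative to `g`: `‖Pg‖² ≥ ‖g‖²/2`, and `‖g‖²‖PᵀPg‖²
≤ ‖Pg‖²(‖Pg‖² + T‖g‖²)` with `T = 3n/(2s)`.

For `g ≠ 0`, let `-θ` be the least eigenvalue of the homogenized matrix. Optimality gives `⟨g, d⟩ =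
-θ` and `⟨d, Hd⟩ ≤ θ` (`IsSubproblemSol.rshtrDir_bounds`). Near `xbar` one has `g ≈ Ae` and `H ≈ A`,
so `‖e + d‖_A² = ‖e‖_A² + 2⟨d, Ae⟩ + ⟨d, Ad⟩` drops by about `θ` at least. Positivity of `PHPᵀ + θ`
on a suitable vector, with the two properties, bounds `θ` below by nearly `‖g‖²/(2Λ(1/2 + T))`; and
`‖g‖² ≈ ‖Ae‖² ≥ m‖e‖_A²`. Since `1/2 + T < 2(√(n/s) + 1)²` strictly, there is room for all
perturbation errors (`inner_add_le_of_perturbation`, `exists_radius_contraction`).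

Each property fails with probability at most `exp(-s/40)`: they are chi-square tails, applied to the
random `g` because it depends on the past only. These failures make up `2 exp(-Cs/4)`. Almost sure
convergence forces local mode eventually and makes the probability of not yet being local tend to
`0`; the term `8 exp(-s)` absorbs it for large `k`. -/

/-! ### Chi-square tails and linear combinations of independent Gaussians. -/

theorem integrable_exp_sq_gaussianReal {v : NNReal} (hv : v ≠ 0) {c : ℝ} (hc : c < 1 / 2) :
    Integrable (fun x : ℝ => Real.exp (c / v * x ^ 2)) (gaussianReal 0 v) ∧
      ∫ x, Real.exp (c / v * x ^ 2) ∂(gaussianReal 0 v) = √(1 / (1 - 2 * c)) := by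
  have hv' : (0 : ℝ) < v := by positivity
  have hb : 0 < (1 - 2 * c) / (2 * v) := by apply div_pos <;> linarith
  have key : ∀ x : ℝ, gaussianPDFReal 0 v x * Real.exp (c / v * x ^ 2)
      = (√(2 * Real.pi * v))⁻¹ * Real.exp (-((1 - 2 * c) / (2 * v)) * x ^ 2) := by
    intro x
    rw [gaussianPDFReal, mul_assoc, ← Real.exp_add]
    congr 2
    field_simp
    ring
  constructor
  · rw [gaussianReal_of_var_ne_zero _ hv, integrable_withDensity_iff (measurable_gaussianPDF 0 v)
      (by simp [gaussianPDF])]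
    have : (fun x => Real.exp (c / v * x ^ 2) * (gaussianPDF 0 v x).toReal)
        = fun x => (√(2 * Real.pi * v))⁻¹ * Real.exp (-((1 - 2 * c) / (2 * v)) * x ^ 2) := by
      ext x
      rw [toReal_gaussianPDF, mul_comm, key]
    rw [this]
    exact (integrable_exp_neg_mul_sq hb).const_mul _
  · rw [integral_gaussianReal_eq_integral_smul hv]
    simp only [smul_eq_mul, key]
    rw [integral_const_mul, integral_gaussian, ← Real.sqrt_inv, ← Real.sqrt_mul (by positivity)]
    congr 1
    have : (1 - 2 * c) ≠ 0 := by linarith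
    have := Real.pi_ne_zero
    field_simp

/-- The linear form on `ℝ^ι` with coefficients `a`. -/
noncomputable def coeffForm {ι : Type*} [Fintype ι] (a : ι → ℝ) : (ι → ℝ) →L[ℝ] ℝ :=
  ∑ i, a i • (ContinuousLinearMap.proj i : (ι → ℝ) →L[ℝ] ℝ)

theorem coeffForm_apply {ι : Type*} [Fintype ι] (a x : ι → ℝ) :
    coeffForm a x = ∑ i, a i * x i := by
  simp [coeffForm]

section SumSq

variable {Ω : Type*} [MeasurableSpace Ω] {μ : Measure Ω} [IsProbabilityMeasure μ]

omit [IsProbabilityMeasure μ] in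
theorem mgf_sq_gaussian {Y : Ω → ℝ} {v : NNReal} (hv : v ≠ 0) (hY : HasLaw Y (gaussianReal 0 v) μ)
    {c : ℝ} (hc : c < 1 / 2) :
    Integrable (fun ω => Real.exp (c / v * Y ω ^ 2)) μ ∧
      mgf (fun ω => Y ω ^ 2) μ (c / v) = √(1 / (1 - 2 * c)) := by
  obtain ⟨h1, h2⟩ := integrable_exp_sq_gaussianReal hv hc
  constructor
  · rw [← hY.map_eq] at h1
    exact (integrable_map_measure (by fun_prop) hY.aemeasurable).1 h1
  · rw [← h2, mgf, ← hY.map_eq, integral_map hY.aemeasurable (by fun_prop)]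

omit [IsProbabilityMeasure μ] in
theorem mgf_sum_sq_gaussian {ι : Type*} [Fintype ι] {Y : ι → Ω → ℝ} {v : NNReal} (hv : v ≠ 0)
    (hY : ∀ i, HasLaw (Y i) (gaussianReal 0 v) μ) (hi : iIndepFun Y μ) {c : ℝ} (hc : c < 1 / 2) :
    Integrable (fun ω => Real.exp (c / v * ∑ i, Y i ω ^ 2)) μ ∧
      mgf (fun ω => ∑ i, Y i ω ^ 2) μ (c / v) = √(1 / (1 - 2 * c)) ^ Fintype.card ι := by
  have hi2 : iIndepFun (fun i ω => Y i ω ^ 2) μ := hi.comp (fun _ x => x ^ 2) (by fun_prop)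
  have hm : ∀ i, AEMeasurable (fun ω => Y i ω ^ 2) μ := fun i => (hY i).aemeasurable.pow_const 2
  have e : (fun ω => ∑ i, Y i ω ^ 2) = ∑ i, (fun ω => Y i ω ^ 2) := by
    ext ω; simp
  have h2 : mgf (fun ω => ∑ i, Y i ω ^ 2) μ (c / v) = √(1 / (1 - 2 * c)) ^ Fintype.card ι := by
    rw [e, hi2.mgf_sum₀ hm]
    simp [(mgf_sq_gaussian hv (hY _) hc).2]
  refine ⟨?_, h2⟩
  -- An undefined integral is `0` by convention, so the positive value of the moment generating
  -- function already yields integrability.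
  by_contra h
  have h3 : 0 < √(1 / (1 - 2 * c)) ^ Fintype.card ι :=
    pow_pos (Real.sqrt_pos.2 (by apply div_pos <;> linarith)) _
  rw [← h2, mgf, integral_undef h] at h3
  exact h3.false

theorem sum_sq_gaussian_upper {ι : Type*} [Fintype ι] {Y : ι → Ω → ℝ} {v : NNReal} (hv : v ≠ 0)
    (hY : ∀ i, HasLaw (Y i) (gaussianReal 0 v) μ) (hi : iIndepFun Y μ) :
    μ.real {ω | 3 / 2 * (Fintype.card ι * (v : ℝ)) ≤ ∑ i, Y i ω ^ 2}
      ≤ Real.exp (-(1 / 40) * Fintype.card ι) := by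
  have hv' : (0 : ℝ) < v := by positivity
  obtain ⟨h1, h2⟩ := mgf_sum_sq_gaussian hv hY hi (c := 1 / 4) (by norm_num)
  refine (measure_ge_le_exp_mul_mgf _ (by positivity) h1).trans ?_
  rw [h2, show -(1 / 4 / (v : ℝ)) * (3 / 2 * (Fintype.card ι * v)) = Fintype.card ι * (-(3 / 8)) by
    field_simp; ring, Real.exp_nat_mul, ← mul_pow, mul_comm _ (Fintype.card ι : ℝ),
    Real.exp_nat_mul]
  gcongr
  -- This is `√2 ≤ exp(7/20)`, from `log 2 < 7/10`; the Chernoff exponent is then `-3/8 + 7/20 =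
  -- -1/40`.
  have : √(1 / (1 - 2 * (1 / 4))) ≤ Real.exp (7 / 20) := by
    rw [Real.sqrt_le_left (by positivity), ← Real.exp_nat_mul, ← Real.log_le_iff_le_exp (by norm_num)]
    norm_num
    have := Real.log_two_lt_d9
    linarith
  calc _ ≤ Real.exp (-(3 / 8)) * Real.exp (7 / 20) := by gcongr
    _ = _ := by rw [← Real.exp_add]; norm_num

theorem sum_sq_gaussian_lower {ι : Type*} [Fintype ι] {Y : ι → Ω → ℝ} {v : NNReal} (hv : v ≠ 0)
    (hY : ∀ i, HasLaw (Y i) (gaussianReal 0 v) μ) (hi : iIndepFun Y μ) :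
    μ.real {ω | ∑ i, Y i ω ^ 2 ≤ 1 / 2 * (Fintype.card ι * (v : ℝ))}
      ≤ Real.exp (-(1 / 40) * Fintype.card ι) := by
  have hv' : (0 : ℝ) < v := by positivity
  obtain ⟨h1, h2⟩ := mgf_sum_sq_gaussian hv hY hi (c := -(1 / 2)) (by norm_num)
  refine (measure_le_le_exp_mul_mgf _ (by rw [neg_div]; exact neg_nonpos.2 (by positivity)) h1).trans ?_
  rw [h2, show -(-(1 / 2) / (v : ℝ)) * (1 / 2 * (Fintype.card ι * v)) = Fintype.card ι * (1 / 4) by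
    field_simp; ring, Real.exp_nat_mul, ← mul_pow, mul_comm _ (Fintype.card ι : ℝ),
    Real.exp_nat_mul]
  gcongr
  have : √(1 / (1 - 2 * -(1 / 2))) ≤ Real.exp (-(3 / 10)) := by
    rw [Real.sqrt_le_left (by positivity), ← Real.exp_nat_mul, ← Real.log_le_iff_le_exp (by norm_num)]
    have := Real.log_two_gt_d9
    rw [show (1 : ℝ) / (1 - 2 * -(1 / 2)) = 2⁻¹ by norm_num, Real.log_inv]
    norm_num
    linarith
  calc _ ≤ Real.exp (1 / 4) * Real.exp (-(3 / 10)) := by gcongr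
    _ ≤ _ := by rw [← Real.exp_add]; gcongr; norm_num

/-- Fubini on the product law: a bound valid for each frozen value of `Y` survives when `Y` is
random and independent of `X`. -/
theorem measure_le_of_indepFun {α β : Type*} [MeasurableSpace α] [MeasurableSpace β]
    {X : Ω → α} {Y : Ω → β} (hX : AEMeasurable X μ) (hY : AEMeasurable Y μ) (h : IndepFun X Y μ)
    {B : Set (α × β)} (hB : MeasurableSet B) {p : ℝ} (hp : 0 ≤ p)
    (hBp : ∀ y, μ.real {ω | (X ω, y) ∈ B} ≤ p) :
    μ.real {ω | (X ω, Y ω) ∈ B} ≤ p := by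
  have : IsProbabilityMeasure (μ.map X) := Measure.isProbabilityMeasure_map hX
  have : IsProbabilityMeasure (μ.map Y) := Measure.isProbabilityMeasure_map hY
  have h1 : μ {ω | (X ω, Y ω) ∈ B} = (μ.map fun ω => (X ω, Y ω)) B :=
    (Measure.map_apply_of_aemeasurable (hX.prodMk hY) hB).symm
  refine ENNReal.toReal_le_of_le_ofReal hp ?_
  rw [h1, (indepFun_iff_map_prod_eq_prod_map_map hX hY).1 h, Measure.prod_apply_symm hB]
  calc _ ≤ ∫⁻ y, ENNReal.ofReal p ∂(μ.map Y) := by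
        refine lintegral_mono fun y => ?_
        rw [Measure.map_apply_of_aemeasurable hX (by exact measurable_prodMk_right hB)]
        rw [ENNReal.le_ofReal_iff_toReal_le (measure_ne_top _ _) hp]
        exact hBp y
    _ = _ := by simp

theorem covariance_linearCombination {ι : Type*} [Fintype ι] {X : ι → Ω → ℝ} {v : NNReal}
    (hX : ∀ i, HasLaw (X i) (gaussianReal 0 v) μ) (hi : iIndepFun X μ) (a b : ι → ℝ) :
    cov[fun ω => ∑ i, a i * X i ω, fun ω => ∑ i, b i * X i ω; μ] = v * ∑ i, a i * b i := by
  classical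
  have hL : ∀ i, MemLp (X i) 2 μ := fun i => (hX i).hasGaussianLaw.memLp_two
  rw [covariance_fun_sum_fun_sum (fun i => (hL i).const_mul _) (fun i => (hL i).const_mul _),
    Finset.mul_sum]
  refine Finset.sum_congr rfl fun i _ => ?_
  rw [Finset.sum_eq_single i]
  · rw [covariance_const_mul_left, covariance_const_mul_right,
      covariance_self (hX i).aemeasurable, (hX i).variance_eq, variance_id_gaussianReal]
    ring
  · intro j _ hj
    rw [covariance_const_mul_left, covariance_const_mul_right,
      (hi.indepFun hj.symm).covariance_eq_zero (hL i) (hL j)]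
    simp
  · simp

theorem hasLaw_linearCombination {ι : Type*} [Fintype ι] {X : ι → Ω → ℝ} {v : NNReal}
    (hX : ∀ i, HasLaw (X i) (gaussianReal 0 v) μ) (hi : iIndepFun X μ) (a : ι → ℝ)
    {w : NNReal} (hw : v * ∑ i, a i * a i = (w : ℝ)) :
    HasLaw (fun ω => ∑ i, a i * X i ω) (gaussianReal 0 w) μ := by
  have hG : HasGaussianLaw (fun ω i => X i ω) μ :=
    hi.hasGaussianLaw fun i => (hX i).hasGaussianLaw
  have hY : HasGaussianLaw (fun ω => ∑ i, a i * X i ω) μ := by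
    simpa only [coeffForm_apply] using hG.map_fun (coeffForm a)
  refine ⟨hY.aemeasurable, ?_⟩
  rw [hY.map_eq_gaussianReal, ← covariance_self hY.aemeasurable, covariance_linearCombination hX hi,
    hw, Real.toNNReal_coe]
  congr 1
  rw [integral_finsetSum _ fun i _ => ((hX i).hasGaussianLaw.integrable).const_mul _]
  refine Finset.sum_eq_zero fun i _ => ?_
  rw [integral_const_mul, (hX i).integral_eq, integral_id_gaussianReal, mul_zero]

theorem iIndepFun_linearCombination {ι κ : Type*} [Fintype ι] [Fintype κ] {X : ι → Ω → ℝ}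
    {v : NNReal} (hX : ∀ i, HasLaw (X i) (gaussianReal 0 v) μ) (hi : iIndepFun X μ)
    (a : κ → ι → ℝ) (ha : ∀ k l, k ≠ l → ∑ i, a k i * a l i = 0) :
    iIndepFun (fun k ω => ∑ i, a k i * X i ω) μ := by
  have hG : HasGaussianLaw (fun ω i => X i ω) μ :=
    hi.hasGaussianLaw fun i => (hX i).hasGaussianLaw
  refine HasGaussianLaw.iIndepFun_of_covariance_eq_zero ?_ fun k l hkl => ?_
  · simpa only [ContinuousLinearMap.coe_pi', coeffForm_apply] using
      hG.map_fun (ContinuousLinearMap.pi fun k => coeffForm (a k))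
  · rw [covariance_linearCombination hX hi, ha k l hkl, mul_zero]

/-- The two families are jointly Gaussian, so orthogonal coefficients, hence zero covariances,
suffice for independence. -/
theorem indepFun_linearCombination {ι κ κ' : Type*} [Fintype ι] [Fintype κ] [Fintype κ']
    {X : ι → Ω → ℝ} {v : NNReal} (hX : ∀ i, HasLaw (X i) (gaussianReal 0 v) μ)
    (hi : iIndepFun X μ) (a : κ → ι → ℝ) (b : κ' → ι → ℝ) (hab : ∀ k l, ∑ i, a k i * b l i = 0) :
    IndepFun (fun ω k => ∑ i, a k i * X i ω) (fun ω l => ∑ i, b l i * X i ω) μ := by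
  have hG : HasGaussianLaw (fun ω i => X i ω) μ :=
    hi.hasGaussianLaw fun i => (hX i).hasGaussianLaw
  refine HasGaussianLaw.indepFun_of_covariance_eval ?_ fun k l => ?_
  · simpa only [ContinuousLinearMap.prod_apply, ContinuousLinearMap.coe_pi', coeffForm_apply] using
      hG.map_fun ((ContinuousLinearMap.pi fun k => coeffForm (a k)).prod
        (ContinuousLinearMap.pi fun l => coeffForm (b l)))
  · rw [covariance_linearCombination hX hi, hab k l, mul_zero]

end SumSq

/-! ### Gaussian matrices acting on a fixed vector. -/

namespace IsGaussianMatrix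

variable {Ω : Type*} [MeasurableSpace Ω] {μ : Measure Ω} [IsProbabilityMeasure μ] {s n : ℕ}
  {P : Ω → Matrix (Fin s) (Fin n) ℝ}

theorem measure_mulVec_lt_le (hP : IsGaussianMatrix μ P) (hs : 1 ≤ s) (g : Fin n → ℝ) :
    μ.real {ω | (P ω *ᵥ g) ⬝ᵥ (P ω *ᵥ g) < 1 / 2 * (g ⬝ᵥ g)} ≤ Real.exp (-(1 / 40) * s) := by
  have hs' : (0 : ℝ) < s := by exact_mod_cast hs
  rcases eq_or_ne g 0 with rfl | hg
  · simp [Real.exp_nonneg]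
  have hg2 : 0 < g ⬝ᵥ g := by simpa using Matrix.dotProduct_star_self_pos_iff.2 hg
  let a : Fin s → Fin s × Fin n → ℝ := fun k p => if p.1 = k then g p.2 else 0
  have haa : ∀ k l, ∑ p, a k p * a l p = if k = l then g ⬝ᵥ g else 0 := by
    intro k l
    rw [Fintype.sum_prod_type]
    split_ifs with h
    · subst h
      simp [a, dotProduct, Finset.sum_ite_irrel]
    · refine Finset.sum_eq_zero fun i _ => Finset.sum_eq_zero fun j _ => ?_
      simp only [a]
      split_ifs <;> simp_all
  have hPg : ∀ ω k, (P ω *ᵥ g) k = ∑ p, a k p * P ω p.1 p.2 := by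
    intro ω k
    rw [Fintype.sum_prod_type]
    simp [a, Matrix.mulVec, dotProduct, mul_comm, Finset.sum_ite_irrel]
  let w : NNReal := (s : NNReal)⁻¹ * ⟨g ⬝ᵥ g, hg2.le⟩
  have hw : (w : ℝ) = (s : ℝ)⁻¹ * (g ⬝ᵥ g) := rfl
  have hw0 : w ≠ 0 := by
    rw [← NNReal.coe_ne_zero, hw]; positivity
  have hlaw := fun k => hasLaw_linearCombination (fun p : Fin s × Fin n => hP.law p.1 p.2) hP.indep
    (a k) (w := w) (by rw [haa, if_pos rfl, hw]; simp)
  have hind := iIndepFun_linearCombination (fun p : Fin s × Fin n => hP.law p.1 p.2) hP.indep a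
    (fun k l h => by rw [haa, if_neg h])
  refine le_trans (measureReal_mono fun ω h => ?_)
    ((sum_sq_gaussian_lower hw0 hlaw hind).trans (by simp))
  simp only [Set.mem_ofPred_eq, dotProduct, hPg, ← pow_two] at h ⊢
  refine h.le.trans (le_of_eq ?_)
  rw [hw]
  simp only [Fintype.card_fin, dotProduct, ← pow_two]
  field_simp

theorem measure_transpose_mulVec_gt_le (hP : IsGaussianMatrix μ P) (hs : 1 ≤ s) (u : Fin s → ℝ) :
    μ.real {ω | 3 / 2 * ((n : ℝ) / s) * (u ⬝ᵥ u) < ((P ω)ᵀ *ᵥ u) ⬝ᵥ ((P ω)ᵀ *ᵥ u)}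
      ≤ Real.exp (-(1 / 40) * n) := by
  have hs' : (0 : ℝ) < s := by exact_mod_cast hs
  rcases eq_or_ne u 0 with rfl | hg
  · simp [Real.exp_nonneg]
  have hg2 : 0 < u ⬝ᵥ u := by simpa using Matrix.dotProduct_star_self_pos_iff.2 hg
  let a : Fin n → Fin s × Fin n → ℝ := fun k p => if p.2 = k then u p.1 else 0
  have haa : ∀ k l, ∑ p, a k p * a l p = if k = l then u ⬝ᵥ u else 0 := by
    intro k l
    rw [Fintype.sum_prod_type]
    split_ifs with h
    · subst h
      simp [a, dotProduct]
    · refine Finset.sum_eq_zero fun i _ => Finset.sum_eq_zero fun j _ => ?_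
      simp only [a]
      split_ifs <;> simp_all
  have hPg : ∀ ω k, ((P ω)ᵀ *ᵥ u) k = ∑ p, a k p * P ω p.1 p.2 := by
    intro ω k
    rw [Fintype.sum_prod_type]
    simp [a, Matrix.mulVec, dotProduct, mul_comm]
  let w : NNReal := (s : NNReal)⁻¹ * ⟨u ⬝ᵥ u, hg2.le⟩
  have hw : (w : ℝ) = (s : ℝ)⁻¹ * (u ⬝ᵥ u) := rfl
  have hw0 : w ≠ 0 := by
    rw [← NNReal.coe_ne_zero, hw]; positivity
  have hlaw := fun k => hasLaw_linearCombination (fun p : Fin s × Fin n => hP.law p.1 p.2) hP.indep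
    (a k) (w := w) (by rw [haa, if_pos rfl, hw]; simp)
  have hind := iIndepFun_linearCombination (fun p : Fin s × Fin n => hP.law p.1 p.2) hP.indep a
    (fun k l h => by rw [haa, if_neg h])
  refine le_trans (measureReal_mono fun ω h => ?_)
    ((sum_sq_gaussian_upper hw0 hlaw hind).trans (by simp))
  simp only [Set.mem_ofPred_eq, dotProduct, hPg, ← pow_two] at h ⊢
  refine le_trans (le_of_eq ?_) h.le
  rw [hw]
  simp only [Fintype.card_fin, dotProduct, ← pow_two]
  field_simp

/-- Replaces a bound on the operator norm of `P`. Put `b = Pg` and `R = P - b gᵀ/‖g‖²`. The rows of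
`R` are orthogonal to `g`, so `R` is independent of `b` and `‖Pᵀu‖² = ‖Rᵀu‖² + ⟨b, u⟩²/‖g‖²`. At `u
= b` the last term is `‖b‖⁴/‖g‖²`, while `b` can be frozen in `‖Rᵀb‖²`, leaving a chi-square tail.
-/
theorem measure_transpose_mulVec_mulVec_gt_le (hP : IsGaussianMatrix μ P) (hs : 1 ≤ s)
    (g : Fin n → ℝ) :
    μ.real {ω | ((P ω *ᵥ g) ⬝ᵥ (P ω *ᵥ g)) *
          ((P ω *ᵥ g) ⬝ᵥ (P ω *ᵥ g) + 3 / 2 * ((n : ℝ) / s) * (g ⬝ᵥ g))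
        < (g ⬝ᵥ g) * (((P ω)ᵀ *ᵥ (P ω *ᵥ g)) ⬝ᵥ ((P ω)ᵀ *ᵥ (P ω *ᵥ g)))}
      ≤ Real.exp (-(1 / 40) * n) := by
  rcases eq_or_ne g 0 with rfl | hg
  · simp [Real.exp_nonneg]
  have hg2 : 0 < g ⬝ᵥ g := by simpa using Matrix.dotProduct_star_self_pos_iff.2 hg
  let a : Fin s → Fin s × Fin n → ℝ := fun k p => if p.1 = k then g p.2 else 0
  -- Coefficients of the entries of `R` in the entries of `P`; `a` holds those of `Pg`.
  let c : Fin s × Fin n → Fin s × Fin n → ℝ := fun q p =>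
    (if p = q then 1 else 0) - (g q.2 / (g ⬝ᵥ g)) * a q.1 p
  have hPg : ∀ ω k, ∑ p, a k p * P ω p.1 p.2 = (P ω *ᵥ g) k := by
    intro ω k
    rw [Fintype.sum_prod_type]
    simp [a, Matrix.mulVec, dotProduct, mul_comm, Finset.sum_ite_irrel]
  have hR : ∀ ω q, ∑ p, c q p * P ω p.1 p.2
      = P ω q.1 q.2 - (g q.2 / (g ⬝ᵥ g)) * (P ω *ᵥ g) q.1 := by
    intro ω q
    simp only [c, sub_mul, Finset.sum_sub_distrib, mul_assoc, ← Finset.mul_sum, hPg]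
    simp
  have hac : ∀ k q, ∑ p, c q p * a k p = 0 := by
    intro k q
    have haa : ∑ p, a q.1 p * a k p = if q.1 = k then g ⬝ᵥ g else 0 := by
      rw [Fintype.sum_prod_type]
      split_ifs with h
      · subst h
        simp [a, dotProduct, Finset.sum_ite_irrel]
      · refine Finset.sum_eq_zero fun i _ => Finset.sum_eq_zero fun j _ => ?_
        simp only [a]
        split_ifs <;> simp_all
    have hq : ∑ p, (if p = q then 1 else 0) * a k p = a k q := by
      simp only [ite_mul, one_mul, zero_mul, Finset.sum_ite_eq', Finset.mem_univ, if_true]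
    simp only [c, sub_mul, Finset.sum_sub_distrib, mul_assoc, ← Finset.mul_sum, haa, hq]
    by_cases h : q.1 = k
    · simp [a, h, hg2.ne']
    · simp [a, h]
  have hind := indepFun_linearCombination (fun p : Fin s × Fin n => hP.law p.1 p.2) hP.indep c a
    (fun q k => hac k q)
  simp only [hPg, hR] at hind
  have hm : ∀ p : Fin s × Fin n, AEMeasurable (fun ω => P ω p.1 p.2) μ :=
    fun p => (hP.law p.1 p.2).aemeasurable
  have hmb : ∀ k, AEMeasurable (fun ω => (P ω *ᵥ g) k) μ := fun k => by
    simp only [← hPg]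
    exact Finset.aemeasurable_fun_sum _ fun p _ => (hm p).const_mul _
  have hdot : ∀ ω u, ∑ j, (∑ i, (P ω i j - g j / (g ⬝ᵥ g) * (P ω *ᵥ g) i) * u i) ^ 2
      = ((P ω)ᵀ *ᵥ u) ⬝ᵥ ((P ω)ᵀ *ᵥ u) - ((P ω *ᵥ g) ⬝ᵥ u) ^ 2 / (g ⬝ᵥ g) := by
    intro ω u
    have h1 : ∀ j, ∑ i, (P ω i j - g j / (g ⬝ᵥ g) * (P ω *ᵥ g) i) * u i
        = ((P ω)ᵀ *ᵥ u) j - g j / (g ⬝ᵥ g) * ((P ω *ᵥ g) ⬝ᵥ u) := by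
      intro j
      simp only [sub_mul, Finset.sum_sub_distrib, mul_assoc, ← Finset.mul_sum]
      rfl
    have h2 : g ⬝ᵥ ((P ω)ᵀ *ᵥ u) = (P ω *ᵥ g) ⬝ᵥ u := by
      rw [Matrix.dotProduct_mulVec, Matrix.vecMul_transpose]
    simp only [h1, ← h2]
    generalize (P ω)ᵀ *ᵥ u = z
    have h3 : ∀ j, (z j - g j / (g ⬝ᵥ g) * (g ⬝ᵥ z)) ^ 2 = z j * z j
        - 2 * ((g ⬝ᵥ z) / (g ⬝ᵥ g)) * (g j * z j) + ((g ⬝ᵥ z) / (g ⬝ᵥ g)) ^ 2 * (g j * g j) := by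
      intro j; ring
    simp only [h3, Finset.sum_add_distrib, Finset.sum_sub_distrib, ← Finset.mul_sum]
    change z ⬝ᵥ z - 2 * ((g ⬝ᵥ z) / (g ⬝ᵥ g)) * (g ⬝ᵥ z)
      + ((g ⬝ᵥ z) / (g ⬝ᵥ g)) ^ 2 * (g ⬝ᵥ g) = _
    field_simp
    ring
  let B : Set ((Fin s × Fin n → ℝ) × (Fin s → ℝ)) :=
    {z | 3 / 2 * ((n : ℝ) / s) * (∑ i, z.2 i * z.2 i) < ∑ j, (∑ i, z.1 (i, j) * z.2 i) ^ 2}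
  have hB : MeasurableSet B := measurableSet_lt (by fun_prop) (by fun_prop)
  have hmR : AEMeasurable
      (fun ω (q : Fin s × Fin n) => P ω q.1 q.2 - g q.2 / (g ⬝ᵥ g) * (P ω *ᵥ g) q.1) μ :=
    aemeasurable_pi_lambda _ fun q => (hm q).sub ((hmb q.1).const_mul _)
  refine le_trans (measureReal_mono fun ω h => ?_) (measure_le_of_indepFun hmR
    (aemeasurable_pi_lambda _ hmb) hind hB (Real.exp_nonneg _) fun u => ?_)
  · simp only [Set.mem_ofPred_eq, B] at h ⊢
    rw [hdot]
    change 3 / 2 * ((n : ℝ) / s) * ((P ω *ᵥ g) ⬝ᵥ (P ω *ᵥ g)) < _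
    generalize (P ω *ᵥ g) ⬝ᵥ (P ω *ᵥ g) = β at *
    rw [lt_sub_iff_add_lt, ← mul_lt_mul_iff_right₀ hg2]
    refine lt_of_eq_of_lt ?_ h
    rw [mul_add, mul_div_cancel₀ _ hg2.ne']
    ring
  -- For frozen `u`, `‖Rᵀu‖ ≤ ‖Pᵀu‖`, so the tail bound for `Pᵀu` applies.
  · refine le_trans (measureReal_mono fun ω h => ?_) (hP.measure_transpose_mulVec_gt_le hs u)
    simp only [Set.mem_ofPred_eq, B] at h ⊢
    rw [hdot] at h
    change 3 / 2 * ((n : ℝ) / s) * (u ⬝ᵥ u) < _ at h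
    have : 0 ≤ ((P ω *ᵥ g) ⬝ᵥ u) ^ 2 / (g ⬝ᵥ g) := by positivity
    linarith

end IsGaussianMatrix

/-! ### Optimality conditions of the homogenized subproblem. -/

section Subproblem

theorem homMat_mulVec_homVec {s : ℕ} (H : Matrix (Fin s) (Fin s) ℝ) (g : Fin s → ℝ) (δ : ℝ)
    (v : Fin s → ℝ) (t : ℝ) :
    homMat H g δ *ᵥ homVec v t = homVec (H *ᵥ v + t • g) (g ⬝ᵥ v - δ * t) := by
  ext (i | i) <;>
    simp [homMat, homVec, Matrix.mulVec, dotProduct, Fintype.sum_sum_type, mul_comm, sub_eq_add_neg]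

theorem homVec_dotProduct_homVec {s : ℕ} (v v' : Fin s → ℝ) (t t' : ℝ) :
    homVec v t ⬝ᵥ homVec v' t' = v ⬝ᵥ v' + t * t' := by
  simp [homVec, dotProduct, Fintype.sum_sum_type]

theorem IsSubproblemSol.dotProduct_mulVec_le_zero {s : ℕ} {H : Matrix (Fin s) (Fin s) ℝ}
    {v : Fin s → ℝ} {t : ℝ} (h : IsSubproblemSol H 0 0 v t) : v ⬝ᵥ H *ᵥ v ≤ 0 := by
  have h0 := h.2 (show (0 : Fin s ⊕ Unit → ℝ) ∈ _ by simp)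
  simpa [homMat_mulVec_homVec, homVec_dotProduct_homVec] using h0

/-- The optimal value `q₀` is negative, so the minimizer lies on the unit sphere and is an
eigenvector for the least eigenvalue `q₀ = -θ`. If `t` vanished, `v` would be an eigenvector of `H ⪰
0` with eigenvalue `-θ < 0`. -/
theorem IsSubproblemSol.stationary {s : ℕ} {H : Matrix (Fin s) (Fin s) ℝ} (hH : H.PosSemidef)
    {g : Fin s → ℝ} (hg : g ≠ 0) {v : Fin s → ℝ} {t : ℝ} (h : IsSubproblemSol H g 0 v t) :
    t ≠ 0 ∧ ∃ θ, 0 < θ ∧ θ = -(g ⬝ᵥ (t⁻¹ • v)) ∧ H *ᵥ (t⁻¹ • v) + θ • (t⁻¹ • v) = -g := by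
  have hpsd : ∀ u, 0 ≤ u ⬝ᵥ H *ᵥ u := fun u => by simpa using hH.dotProduct_mulVec_nonneg u
  have hg2 : 0 < g ⬝ᵥ g := by simpa using Matrix.dotProduct_star_self_pos_iff.2 hg
  set M := homMat H g 0 with hM
  set u₀ := homVec v t with hu₀
  obtain ⟨h1, h2⟩ := h
  have hMs : M.IsHermitian := by
    rw [hM, homMat, Matrix.isHermitian_fromBlocks_iff]
    refine ⟨hH.1, ?_, ?_, ?_⟩ <;> ext <;> simp
  set q₀ := u₀ ⬝ᵥ M *ᵥ u₀ with hq₀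
  have hhom : ∀ u, q₀ * (u ⬝ᵥ u) ≤ u ⬝ᵥ M *ᵥ u := by
    intro u
    rcases eq_or_ne u 0 with rfl | hu
    · simp
    have hu2 : 0 < u ⬝ᵥ u := by simpa using Matrix.dotProduct_star_self_pos_iff.2 hu
    have := h2 (show (√(u ⬝ᵥ u))⁻¹ • u ∈ _ by
      simp only [Set.mem_ofPred_eq, smul_dotProduct, dotProduct_smul, smul_eq_mul]
      rw [← mul_assoc, ← mul_inv, Real.mul_self_sqrt hu2.le, inv_mul_cancel₀ hu2.ne'])
    simp only [Set.mem_ofPred_eq, smul_dotProduct, dotProduct_smul, smul_eq_mul,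
      Matrix.mulVec_smul] at this
    rw [← mul_assoc, ← mul_inv, Real.mul_self_sqrt hu2.le, inv_mul_eq_div, le_div_iff₀ hu2] at this
    exact this
  have hneg : q₀ < 0 := by
    by_contra! hq
    -- A scaled negative gradient with `t = 1` makes the form negative; the `+ 1` keeps the
    -- denominator positive when `g ⬝ᵥ H *ᵥ g = 0`.
    have key : 0 ≤ homVec ((-((g ⬝ᵥ g) / (g ⬝ᵥ H *ᵥ g + 1))) • g) 1 ⬝ᵥ
        M *ᵥ homVec ((-((g ⬝ᵥ g) / (g ⬝ᵥ H *ᵥ g + 1))) • g) 1 :=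
      (mul_nonneg hq (Fintype.sum_nonneg fun _ => mul_self_nonneg _)).trans (hhom _)
    rw [hM, homMat_mulVec_homVec, homVec_dotProduct_homVec] at key
    simp only [Matrix.mulVec_smul, smul_dotProduct, dotProduct_smul, smul_eq_mul, dotProduct_add,
      one_smul, zero_mul, sub_zero, one_mul] at key
    have hη := hpsd g
    generalize g ⬝ᵥ H *ᵥ g = η at *
    generalize g ⬝ᵥ g = γ at *
    have h4 : -(γ / (η + 1)) * (-(γ / (η + 1)) * η + γ) + -(γ / (η + 1)) * γ
        = -(γ ^ 2 / (η + 1) ^ 2 * (η + 2)) := by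
      field_simp
      ring
    have h5 : 0 < γ ^ 2 / (η + 1) ^ 2 * (η + 2) := by positivity
    linarith
  have hnorm : 1 ≤ u₀ ⬝ᵥ u₀ := by
    have := hhom u₀
    by_contra! hlt
    nlinarith
  have hpos : (M + (-q₀) • 1).PosSemidef := by
    refine Matrix.PosSemidef.of_dotProduct_mulVec_nonneg ?_ fun u => ?_
    · refine hMs.add ?_
      simp [Matrix.IsHermitian]
    · have := hhom u
      simp only [star_trivial, Matrix.add_mulVec, Matrix.smul_mulVec, Matrix.one_mulVec,
        dotProduct_add, dotProduct_smul, smul_eq_mul]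
      linarith
  have hker : (M + (-q₀) • 1) *ᵥ u₀ = 0 := by
    -- A semidefinite form vanishes at a vector only if the vector lies in the kernel.
    rw [← hpos.dotProduct_mulVec_zero_iff]
    refine le_antisymm ?_ (hpos.dotProduct_mulVec_nonneg u₀)
    simp only [star_trivial, Matrix.add_mulVec, Matrix.smul_mulVec, Matrix.one_mulVec,
        dotProduct_add, dotProduct_smul, smul_eq_mul, ← hq₀]
    nlinarith [h1.out]
  rw [Matrix.add_mulVec, Matrix.smul_mulVec, Matrix.one_mulVec, hM, hu₀, homMat_mulVec_homVec]
    at hker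
  have e1 : H *ᵥ v + t • g + (-q₀) • v = 0 := by
    ext i
    simpa [homVec] using congrFun hker (Sum.inl i)
  have e2 : g ⬝ᵥ v + (-q₀) * t = 0 := by
    simpa [homVec] using congrFun hker (Sum.inr ())
  have ht : t ≠ 0 := by
    rintro rfl
    have h3 := congrArg (fun z => v ⬝ᵥ z) e1
    simp only [zero_smul, add_zero, dotProduct_add, dotProduct_smul, dotProduct_zero,
      smul_eq_mul] at h3
    rw [hu₀, homVec_dotProduct_homVec] at hnorm
    nlinarith [hpsd v]
  refine ⟨ht, -q₀, by linarith, ?_, ?_⟩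
  · rw [dotProduct_smul, smul_eq_mul]
    field_simp
    linarith
  · rw [Matrix.mulVec_smul, smul_comm, ← smul_add, ← add_left_inj (t⁻¹ • t • g), ← smul_add,
      add_right_comm, e1, smul_zero, inv_smul_smul₀ ht, neg_add_cancel]

theorem dotProduct_mul_mul_transpose_mulVec {s n : ℕ} (P : Matrix (Fin s) (Fin n) ℝ)
    (H : Matrix (Fin n) (Fin n) ℝ) (u u' : Fin s → ℝ) :
    u ⬝ᵥ (P * H * Pᵀ) *ᵥ u' = (Pᵀ *ᵥ u) ⬝ᵥ H *ᵥ (Pᵀ *ᵥ u') := by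
  rw [Matrix.mul_assoc, ← Matrix.mulVec_mulVec, Matrix.dotProduct_mulVec, ← Matrix.mulVec_transpose,
    Matrix.mulVec_mulVec]

theorem IsSubproblemSol.rshtrDir_bounds {s n : ℕ} {P : Matrix (Fin s) (Fin n) ℝ}
    {H : Matrix (Fin n) (Fin n) ℝ} (hH : H.PosSemidef) {g : Fin n → ℝ} (hg : P *ᵥ g ≠ 0)
    {v : Fin s → ℝ} {t : ℝ} (h : IsSubproblemSol (P * H * Pᵀ) (P *ᵥ g) 0 v t) :
    ∃ θ, 0 < θ ∧ g ⬝ᵥ (rshtrDir P v t).ofLp = -θ ∧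
      (rshtrDir P v t).ofLp ⬝ᵥ H *ᵥ (rshtrDir P v t).ofLp ≤ θ ∧
      ((P *ᵥ g) ⬝ᵥ (P *ᵥ g)) ^ 2 ≤ θ * ((Pᵀ *ᵥ (P *ᵥ g)) ⬝ᵥ H *ᵥ (Pᵀ *ᵥ (P *ᵥ g))
        + θ * ((P *ᵥ g) ⬝ᵥ (P *ᵥ g))) := by
  have hA : (P * H * Pᵀ).PosSemidef := by
    simpa using hH.mul_mul_conjTranspose_same P
  obtain ⟨ht, θ, hθ, h1, h2⟩ := h.stationary hA hg
  have hd : (rshtrDir P v t).ofLp = Pᵀ *ᵥ (t⁻¹ • v) := by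
    simp [rshtrDir, ht, Matrix.mulVec_smul]
  rw [hd]
  generalize t⁻¹ • v = w at *
  have hbw : ∀ u, u ⬝ᵥ (P * H * Pᵀ) *ᵥ w + θ * (u ⬝ᵥ w) = -(u ⬝ᵥ P *ᵥ g) := fun u => by
    rw [← dotProduct_neg, ← h2, dotProduct_add, dotProduct_smul, smul_eq_mul]
  have hww : 0 ≤ w ⬝ᵥ w := Fintype.sum_nonneg fun _ => mul_self_nonneg _
  refine ⟨θ, hθ, ?_, ?_, ?_⟩
  · rw [Matrix.dotProduct_mulVec, Matrix.vecMul_transpose, h1, neg_neg]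
  · rw [← dotProduct_mul_mul_transpose_mulVec]
    have := hbw w
    rw [dotProduct_comm w (P *ᵥ g)] at this
    nlinarith
  · rw [← dotProduct_mul_mul_transpose_mulVec]
    set b := P *ᵥ g
    set A := P * H * Pᵀ
    -- With `(A + θ)w = -b` and `⟨b, w⟩ = -θ`, the form of `A + θ` at `b + cw` is `⟨b, Ab⟩ + θ‖b‖² -
    -- 2c‖b‖² + c²θ`; the choice `c = ‖b‖²/θ` minimizes it.
    have hq := hA.dotProduct_mulVec_nonneg (b + ((b ⬝ᵥ b) / θ) • w)
    have hr : 0 ≤ (b + ((b ⬝ᵥ b) / θ) • w) ⬝ᵥ (b + ((b ⬝ᵥ b) / θ) • w) := Fintype.sum_nonneg fun _ => mul_self_nonneg _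
    have hsymm : w ⬝ᵥ A *ᵥ b = b ⬝ᵥ A *ᵥ w := by
      rw [Matrix.dotProduct_mulVec, ← Matrix.mulVec_transpose, dotProduct_comm]
      have : A.IsSymm := by simpa using hA.1
      rw [this.eq]
    simp only [star_trivial, Matrix.mulVec_add, Matrix.mulVec_smul, dotProduct_add, add_dotProduct,
      smul_dotProduct, dotProduct_smul, smul_eq_mul, hsymm] at hq hr
    have e1 := hbw b
    have e2 := hbw w
    rw [dotProduct_comm w b] at e2 hr
    have e3 : b ⬝ᵥ w = -θ := by linarith
    rw [e3] at e1 e2 hr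
    generalize b ⬝ᵥ A *ᵥ w = p at *
    generalize w ⬝ᵥ A *ᵥ w = q at *
    generalize b ⬝ᵥ A *ᵥ b = r at *
    generalize b ⬝ᵥ b = β at *
    generalize w ⬝ᵥ w = ω at *
    have hp : p = -β + θ * θ := by linarith
    have hq' : q = θ - θ * ω := by linarith
    subst hp hq'
    have h5 : 0 ≤ r + θ * β - β ^ 2 / θ := by
      have : r + θ * β - β ^ 2 / θ = (r + β / θ * (-β + θ * θ)
        + β / θ * (-β + θ * θ + β / θ * (θ - θ * ω)))
        + θ * (β + β / θ * -θ + β / θ * (-θ + β / θ * ω)) := by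
        field_simp
        ring
      rw [this]
      refine add_nonneg ?_ (mul_nonneg hθ.le ?_)
      · convert hq using 1
      · convert hr using 1
    rw [sub_nonneg, div_le_iff₀ hθ] at h5
    linarith

theorem IsSubproblemSol.rshtrDir_dotProduct_le_zero {s n : ℕ} {P : Matrix (Fin s) (Fin n) ℝ}
    {H : Matrix (Fin n) (Fin n) ℝ} {v : Fin s → ℝ} {t : ℝ}
    (h : IsSubproblemSol (P * H * Pᵀ) 0 0 v t) :
    (rshtrDir P v t).ofLp ⬝ᵥ H *ᵥ (rshtrDir P v t).ofLp ≤ 0 := by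
  have h0 := h.dotProduct_mulVec_le_zero
  rw [dotProduct_mul_mul_transpose_mulVec] at h0
  unfold rshtrDir
  split_ifs
  · simp only [Matrix.mulVec_smul, dotProduct_smul, smul_dotProduct, smul_eq_mul, ← mul_assoc]
    exact mul_nonpos_of_nonneg_of_nonpos (mul_self_nonneg _) h0
  · exact h0

end Subproblem

/-! ### Symmetry of the Hessian and first-order expansion at the critical point. -/

section Hessian

variable {n : ℕ} {f : EuclideanSpace ℝ (Fin n) → ℝ}

theorem hessMat_mulVec (x y : EuclideanSpace ℝ (Fin n)) : hessMat f x *ᵥ y.ofLp = (hessOp f x y).ofLp := by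
  have hy : y = ∑ j, y j • EuclideanSpace.single j (1 : ℝ) := by
    ext i
    simp [Finset.sum_apply, Pi.single_apply]
  ext i
  conv_rhs => rw [hy, map_sum]
  simp [hessMat, Matrix.mulVec, dotProduct, mul_comm]

theorem dotProduct_eq_inner (x y : EuclideanSpace ℝ (Fin n)) : x.ofLp ⬝ᵥ y.ofLp = inner ℝ x y := by
  simp [PiLp.inner_apply, dotProduct, mul_comm]

theorem dotProduct_hessMat_mulVec (x z y : EuclideanSpace ℝ (Fin n)) :
    z.ofLp ⬝ᵥ hessMat f x *ᵥ y.ofLp = inner ℝ z (hessOp f x y) := by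
  rw [hessMat_mulVec, dotProduct_eq_inner]

theorem differentiable_gradient (hf : ContDiff ℝ 2 f) : Differentiable ℝ (∇ f) := by
  have h : ContDiff ℝ 1 (fderiv ℝ f) := hf.fderiv_right (by norm_num)
  exact (InnerProductSpace.toDual ℝ (EuclideanSpace ℝ (Fin n))).symm.differentiable.comp (h.differentiable (by norm_num))

theorem inner_hessOp (hf : ContDiff ℝ 2 f) (x u w : EuclideanSpace ℝ (Fin n)) :
    inner ℝ (hessOp f x u) w = fderiv ℝ (fderiv ℝ f) x u w := by
  have h : ContDiff ℝ 1 (fderiv ℝ f) := hf.fderiv_right (by norm_num)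
  have h1 : HasFDerivAt (fderiv ℝ f) (fderiv ℝ (fderiv ℝ f) x) x :=
    (h.differentiable (by norm_num) x).hasFDerivAt
  have h3 : HasFDerivAt (fun y => inner ℝ (∇ f y) w)
      ((innerSL ℝ w).comp (hessOp f x)) x := by
    have := (innerSL ℝ w).hasFDerivAt.comp x (differentiable_gradient hf x).hasFDerivAt
    simpa [Function.comp_def, real_inner_comm, hessOp] using this
  have h4 : HasFDerivAt (fun y => inner ℝ (∇ f y) w)
      ((ContinuousLinearMap.apply ℝ ℝ w).comp (fderiv ℝ (fderiv ℝ f) x)) x := by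
    have := (ContinuousLinearMap.apply ℝ ℝ w).hasFDerivAt.comp x h1
    refine this.congr_of_eventuallyEq (Eventually.of_forall fun y => ?_)
    simp [gradient]
  have := congrArg (fun L => L u) (h3.unique h4)
  simpa [real_inner_comm] using this

theorem inner_hessOp_comm (hf : ContDiff ℝ 2 f) (x u w : EuclideanSpace ℝ (Fin n)) :
    inner ℝ (hessOp f x u) w = inner ℝ u (hessOp f x w) := by
  rw [real_inner_comm (hessOp f x w), inner_hessOp hf, inner_hessOp hf]
  exact (hf.contDiffAt.isSymmSndFDerivAt (by simp)) u w

theorem hessMat_isHermitian (hf : ContDiff ℝ 2 f) (x : EuclideanSpace ℝ (Fin n)) : (hessMat f x).IsHermitian := by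
  ext i j
  have := inner_hessOp_comm hf x (EuclideanSpace.single i 1) (EuclideanSpace.single j 1)
  simpa [hessMat, EuclideanSpace.inner_single_left, EuclideanSpace.inner_single_right] using this

theorem gradient_local_bounds (hf : ContDiff ℝ 2 f) {M : ℝ}
    (hM : ∀ x y, ‖hessOp f x - hessOp f y‖ ≤ M * ‖x - y‖) {xbar : EuclideanSpace ℝ (Fin n)} (hg : ∇ f xbar = 0)
    {ε : ℝ} (hε : 0 < ε) :
    ∃ r > 0, ∀ x, ‖x - xbar‖ < r → ‖∇ f x - hessOp f xbar (x - xbar)‖ ≤ ε * ‖x - xbar‖ ∧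
      ‖hessOp f x - hessOp f xbar‖ ≤ ε ∧ ‖∇ f x‖ ≤ ε := by
  have hd := differentiable_gradient hf
  have h1 : ∀ᶠ x in 𝓝 xbar, ‖∇ f x - hessOp f xbar (x - xbar)‖ ≤ ε * ‖x - xbar‖ := by
    simpa [hg, hessOp] using (hd xbar).hasFDerivAt.isLittleO.def hε
  have h2 : ∀ᶠ x in 𝓝 xbar, ‖hessOp f x - hessOp f xbar‖ ≤ ε := by
    have : Tendsto (fun x => M * ‖x - xbar‖) (𝓝 xbar) (𝓝 (M * ‖xbar - xbar‖)) :=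
      (by fun_prop : Continuous fun x => M * ‖x - xbar‖).tendsto _
    rw [sub_self, norm_zero, mul_zero] at this
    filter_upwards [this.eventually_le_const hε] with x hx using (hM x xbar).trans hx
  have h3 : ∀ᶠ x in 𝓝 xbar, ‖∇ f x‖ ≤ ε := by
    have : Tendsto (fun x => ‖∇ f x‖) (𝓝 xbar) (𝓝 ‖∇ f xbar‖) :=
      hd.continuous.norm.tendsto _
    rw [hg, norm_zero] at this
    exact this.eventually_le_const hε
  obtain ⟨r, hr, h⟩ := Metric.eventually_nhds_iff.1 (h1.and (h2.and h3))
  exact ⟨r, hr, fun x hx => h (by rwa [dist_eq_norm])⟩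

end Hessian

/-! ### Rayleigh bounds by extreme eigenvalues. -/

section Eigenvalues

variable {n : ℕ} {A : Matrix (Fin n) (Fin n) ℝ}

theorem lambdaMin_mul_le (hA : A.IsHermitian) (z : Fin n → ℝ) :
    lambdaMin A * (z ⬝ᵥ z) ≤ z ⬝ᵥ A *ᵥ z := by
  have hbdd : BddBelow (spectrum ℝ A) := (Matrix.finite_real_spectrum (A := A)).bddBelow
  have : (A - algebraMap ℝ _ (lambdaMin A)).PosSemidef := by
    rw [Matrix.posSemidef_iff_isHermitian_and_spectrum_nonneg]
    refine ⟨hA.sub (by simp [Matrix.IsHermitian, Matrix.algebraMap_eq_diagonal]), ?_⟩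
    rw [← spectrum.sub_singleton_eq]
    rintro _ ⟨y, hy, _, rfl, rfl⟩
    exact sub_nonneg.2 (csInf_le hbdd hy)
  have h := this.dotProduct_mulVec_nonneg z
  rw [Matrix.sub_mulVec, Algebra.algebraMap_eq_smul_one, Matrix.smul_mulVec, Matrix.one_mulVec] at h
  simpa using h

theorem le_lambdaMax_mul (hA : A.IsHermitian) (z : Fin n → ℝ) :
    z ⬝ᵥ A *ᵥ z ≤ lambdaMax A * (z ⬝ᵥ z) := by
  have hbdd : BddAbove (spectrum ℝ A) := (Matrix.finite_real_spectrum (A := A)).bddAbove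
  have : (algebraMap ℝ _ (lambdaMax A) - A).PosSemidef := by
    rw [Matrix.posSemidef_iff_isHermitian_and_spectrum_nonneg]
    refine ⟨.sub (by simp [Matrix.IsHermitian, Matrix.algebraMap_eq_diagonal]) hA, ?_⟩
    rw [← spectrum.singleton_sub_eq]
    rintro _ ⟨_, rfl, y, hy, rfl⟩
    exact sub_nonneg.2 (le_csSup hbdd hy)
  have h := this.dotProduct_mulVec_nonneg z
  rw [Matrix.sub_mulVec, Algebra.algebraMap_eq_smul_one, Matrix.smul_mulVec, Matrix.one_mulVec] at h
  simpa using h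

theorem lambdaMin_pos [NeZero n] (hA : A.PosDef) : 0 < lambdaMin A := by
  have hfin : (spectrum ℝ A).Finite := Matrix.finite_real_spectrum
  have hne : (spectrum ℝ A).Nonempty := by
    rw [hA.1.spectrum_real_eq_range_eigenvalues]
    exact Set.range_nonempty _
  have hmem := hne.csInf_mem hfin
  rw [hA.1.spectrum_real_eq_range_eigenvalues] at hmem
  obtain ⟨i, hi⟩ := hmem
  rw [lambdaMin, hA.1.spectrum_real_eq_range_eigenvalues, ← hi]
  exact hA.eigenvalues_pos i

end Eigenvalues

/-! ### One-step decrease in the energy norm. -/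

/-- Lower bound on `θ`, with `G = ‖g‖²`, `β = ‖Pg‖²`, `γ = ‖PᵀPg‖²`. No upper bound on `β` is
needed: cancelling one factor `β` leaves `β(G - θa) ≤ θ(aT + ε)G`. If `G > θa`, the lower bound on
`β` finishes; otherwise `G ≤ θa` is already enough. -/
theorem half_mul_le_of_sq_le {β G T a ε θ γ : ℝ} (hG : 0 < G) (hT : 0 ≤ T) (ha : 0 < a)
    (hε : 0 ≤ ε) (hθ : 0 < θ) (hθε : θ ≤ ε) (hβ : 1 / 2 * G ≤ β) (hγ : G * γ ≤ β * (β + T * G))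
    (h : β ^ 2 ≤ θ * (a * γ + θ * β)) : 1 / 2 * G ≤ θ * (a * (1 / 2 + T) + ε) := by
  have hβ0 : 0 < β := by linarith
  have h1 : β * (β * G) ≤ β * (θ * (a * (β + T * G) + ε * G)) := by
    have e1 : θ * a * (G * γ) ≤ θ * a * (β * (β + T * G)) := by gcongr
    have e2 : θ * β * θ * G ≤ θ * β * ε * G := by gcongr
    have e3 : β ^ 2 * G ≤ θ * (a * γ + θ * β) * G := by gcongr
    linarith
  have h2 := le_of_mul_le_mul_left h1 hβ0
  have h3 : β * (G - θ * a) ≤ θ * (a * T + ε) * G := by linarith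
  rcases le_or_gt G (θ * a) with h4 | h4
  · have : 0 ≤ θ * a * T := by positivity
    have : 0 ≤ θ * ε := by positivity
    linarith
  · have h5 : 1 / 2 * G * (G - θ * a) ≤ θ * (a * T + ε) * G :=
      (mul_le_mul_of_nonneg_right hβ (by linarith)).trans h3
    have h6 : G * (1 / 2 * (G - θ * a)) ≤ G * (θ * (a * T + ε)) := by linarith
    have := le_of_mul_le_mul_left h6 hG
    linarith

/-- At `ε = 0` the right-hand side equals `1 / (2 * (Λ * (1 / 2 + T)))`, so the strict inequality
persists for small `ε` by continuity. -/
theorem exists_perturbation_radius {m Λ T σ : ℝ} (hm : 0 < m) (hΛ : 0 < Λ) (hT : 0 ≤ T)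
    (hσ : σ < 1 / (2 * (Λ * (1 / 2 + T)))) :
    ∃ ε > 0, ε ≤ m / 2 ∧
      σ ≤ (1 - ε / m) ^ 2 / (2 * ((Λ + ε) * (1 / 2 + T) + ε)) - 24 * ε / m ^ 2 := by
  have hc : ContinuousAt (fun ε : ℝ => (1 - ε / m) ^ 2 / (2 * ((Λ + ε) * (1 / 2 + T) + ε))
      - 24 * ε / m ^ 2) 0 := by
    refine ContinuousAt.sub (ContinuousAt.div (by fun_prop) (by fun_prop) ?_) (by fun_prop)
    simp only [add_zero]
    positivity
  have h1 : ∀ᶠ ε in 𝓝[>] (0 : ℝ), σ < (1 - ε / m) ^ 2 / (2 * ((Λ + ε) * (1 / 2 + T) + ε))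
      - 24 * ε / m ^ 2 := by
    refine nhdsWithin_le_nhds (hc.eventually (lt_mem_nhds ?_))
    simpa using hσ
  have h2 : ∀ᶠ ε in 𝓝[>] (0 : ℝ), ε < m / 2 :=
    nhdsWithin_le_nhds (Iio_mem_nhds (by positivity))
  obtain ⟨ε, ⟨h3, h4⟩, h5⟩ := ((h1.and h2).and self_mem_nhdsWithin).exists
  exact ⟨ε, h5, h4.le, h3.le⟩

set_option maxHeartbeats 1000000 in
theorem inner_add_le_of_perturbation {E : Type*} [NormedAddCommGroup E] [InnerProductSpace ℝ E]
    {B A : E →L[ℝ] E} {e g d : E} {θ m Λ ε T σ β γ : ℝ}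
    (hA : ∀ x y, inner ℝ (A x) y = inner ℝ x (A y)) (hm : 0 < m) (hΛ : 0 < Λ) (hT : 0 ≤ T)
    (hmA : ∀ z, m * ‖z‖ ^ 2 ≤ inner ℝ z (A z))
    (hε : 0 < ε) (hεm : ε ≤ m / 2)
    (hσ0 : 0 ≤ σ)
    (hσ : σ ≤ (1 - ε / m) ^ 2 / (2 * ((Λ + ε) * (1 / 2 + T) + ε)) - 24 * ε / m ^ 2)
    (hge : ‖g - A e‖ ≤ ε * ‖e‖) (hB : ‖B - A‖ ≤ ε) (hgε : ‖g‖ ≤ ε) (hg : g ≠ 0)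
    (hθ : 0 < θ) (hgd : inner ℝ g d = -θ) (hdB : inner ℝ d (B d) ≤ θ)
    (hβ : 1 / 2 * ‖g‖ ^ 2 ≤ β) (hγ : ‖g‖ ^ 2 * γ ≤ β * (β + T * ‖g‖ ^ 2))
    (h : β ^ 2 ≤ θ * ((Λ + ε) * γ + θ * β)) :
    inner ℝ (e + d) (A (e + d)) ≤ (1 - σ * m) * inner ℝ e (A e) := by
  have hg0 : 0 < ‖g‖ := norm_pos_iff.2 hg
  have hpert : ∀ z, |inner ℝ z (B z) - inner ℝ z (A z)| ≤ ε * ‖z‖ ^ 2 := by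
    intro z
    rw [← inner_sub_right, ← sub_apply]
    refine (abs_real_inner_le_norm _ _).trans ?_
    have := (B - A).le_of_opNorm_le hB z
    nlinarith [norm_nonneg z]
  have hgd' : θ ≤ ‖g‖ * ‖d‖ := by
    have := neg_le_of_abs_le (abs_real_inner_le_norm g d)
    linarith
  have hd : ‖d‖ ≤ 2 * ‖g‖ / m := by
    have h1 := hmA d
    have h2 := (abs_le.1 (hpert d)).1
    have h3 : m / 2 * ‖d‖ ^ 2 ≤ ‖g‖ * ‖d‖ := by nlinarith [sq_nonneg ‖d‖]
    rcases (norm_nonneg d).eq_or_lt with h0 | h0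
    · rw [← h0]; positivity
    · rw [le_div_iff₀ hm]
      nlinarith
  -- `θ ≤ 2‖g‖²/m`, where one factor `‖g‖` is at most `ε` and the other at most `m/2`.
  have hθε : θ ≤ ε := by
    calc θ ≤ ‖g‖ * (2 * ‖g‖ / m) := hgd'.trans (by gcongr)
      _ ≤ ε * (2 * (m / 2) / m) := by
        gcongr
        linarith
      _ = ε := by field_simp
  have hmain := half_mul_le_of_sq_le (by positivity) hT (by positivity) hε.le hθ hθε hβ hγ h
  have hAe : m * ‖e‖ ≤ ‖A e‖ := by
    have h1 := (hmA e).trans (real_inner_le_norm _ _)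
    rcases (norm_nonneg e).eq_or_lt with h0 | h0
    · rw [← h0]; simp
    · nlinarith
  have hAe2 : m * inner ℝ e (A e) ≤ ‖A e‖ ^ 2 := by
    have h1 := real_inner_le_norm e (A e)
    nlinarith [norm_nonneg (A e)]
  set η := ‖A e‖ with hη
  have hη0 : 0 ≤ η := norm_nonneg _
  have hE : ‖e‖ ≤ η / m := by rw [le_div_iff₀ hm]; linarith
  have hglow : (1 - ε / m) * η ≤ ‖g‖ := by
    have h1 : η ≤ ‖g‖ + ‖g - A e‖ := by
      have := norm_sub_norm_le (A e) g
      rw [norm_sub_rev] at this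
      linarith
    have h2 : ε * ‖e‖ ≤ ε * (η / m) := by gcongr
    have h3 : ε / m * η = ε * (η / m) := by ring
    linarith
  have hgup : ‖g‖ ≤ 2 * η := by
    have h1 : ‖g‖ ≤ η + ‖g - A e‖ := by
      have := norm_sub_norm_le g (A e)
      linarith
    have h2 : ε * ‖e‖ ≤ (m / 2) * (η / m) := by gcongr
    have h3 : (m / 2) * (η / m) = η / 2 := by field_simp
    linarith
  have hd' : ‖d‖ ≤ 4 * η / m := hd.trans (by gcongr ?_ / m; linarith)
  have hε1 : 0 ≤ 1 - ε / m := by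
    rw [sub_nonneg, div_le_one hm]; linarith
  have hD : 0 < (Λ + ε) * (1 / 2 + T) + ε := by positivity
  have hθlow : (1 - ε / m) ^ 2 / (2 * ((Λ + ε) * (1 / 2 + T) + ε)) * η ^ 2 ≤ θ := by
    have h1 : ((1 - ε / m) * η) ^ 2 ≤ ‖g‖ ^ 2 := by gcongr
    rw [div_mul_eq_mul_div, div_le_iff₀ (by positivity)]
    nlinarith
  have hexp : inner ℝ (e + d) (A (e + d))
      = inner ℝ e (A e) + 2 * inner ℝ d (A e) + inner ℝ d (A d) := by
    simp only [map_add, inner_add_left, inner_add_right]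
    rw [← hA e d, real_inner_comm d (A e)]
    ring
  have hlin : inner ℝ d (A e) ≤ -θ + ε * (‖d‖ * ‖e‖) := by
    have h1 : inner ℝ d (A e) = inner ℝ g d - inner ℝ d (g - A e) := by
      rw [inner_sub_right, real_inner_comm d g]; ring
    have h2 := neg_le_of_abs_le (abs_real_inner_le_norm d (g - A e))
    have h3 : ‖d‖ * ‖g - A e‖ ≤ ‖d‖ * (ε * ‖e‖) := by gcongr
    linarith
  have hquad : inner ℝ d (A d) ≤ θ + ε * ‖d‖ ^ 2 := by
    have := (abs_le.1 (hpert d)).1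
    linarith
  have h1 : ‖d‖ * ‖e‖ ≤ 4 * η / m * (η / m) := by gcongr
  have h2 : ‖d‖ ^ 2 ≤ (4 * η / m) ^ 2 := by gcongr
  -- Total perturbation error, using `‖d‖ ≤ 4η/m` and `‖e‖ ≤ η/m`: `24 = 2 · 4 + 4²`.
  have h3 : ε * (2 * (‖d‖ * ‖e‖) + ‖d‖ ^ 2) ≤ 24 * ε / m ^ 2 * η ^ 2 := by
    calc _ ≤ ε * (2 * (4 * η / m * (η / m)) + (4 * η / m) ^ 2) := by gcongr
      _ = _ := by ring
  have h4 : σ * η ^ 2 ≤ θ - 24 * ε / m ^ 2 * η ^ 2 := by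
    calc _ ≤ _ := mul_le_mul_of_nonneg_right hσ (sq_nonneg η)
      _ ≤ _ := by rw [sub_mul]; linarith
  have h5 : σ * (m * inner ℝ e (A e)) ≤ σ * η ^ 2 := by gcongr
  rw [hexp]
  linarith

/-! ### Deterministic local contraction for a well-behaved matrix `P`. -/

section Contraction

variable {n s : ℕ} {f : EuclideanSpace ℝ (Fin n) → ℝ}

theorem matNorm_hessMat (x z : EuclideanSpace ℝ (Fin n)) :
    matNorm (hessMat f x) z = √(inner ℝ z (hessOp f x z)) := by
  rw [matNorm, dotProduct_hessMat_mulVec]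

theorem exists_radius_contraction (hs : 1 ≤ s) (hsn : s ≤ n) {L M : ℝ}
    (hf : HasLipschitzGradHess f L M) {xbar : EuclideanSpace ℝ (Fin n)} (hgrad : ∇ f xbar = 0)
    (hpd : (hessMat f xbar).PosDef) :
    ∃ r > 0, ∀ x, ‖x - xbar‖ < r → ∀ (P : Matrix (Fin s) (Fin n) ℝ) (v : Fin s → ℝ) (t : ℝ),
      IsSubproblemSol (P * hessMat f x * Pᵀ) (P *ᵥ (∇ f x).ofLp) 0 v t →
      1 / 2 * ((∇ f x).ofLp ⬝ᵥ (∇ f x).ofLp)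
        ≤ (P *ᵥ (∇ f x).ofLp) ⬝ᵥ (P *ᵥ (∇ f x).ofLp) →
      ((∇ f x).ofLp ⬝ᵥ (∇ f x).ofLp)
          * ((Pᵀ *ᵥ (P *ᵥ (∇ f x).ofLp)) ⬝ᵥ (Pᵀ *ᵥ (P *ᵥ (∇ f x).ofLp)))
        ≤ ((P *ᵥ (∇ f x).ofLp) ⬝ᵥ (P *ᵥ (∇ f x).ofLp)) *
          ((P *ᵥ (∇ f x).ofLp) ⬝ᵥ (P *ᵥ (∇ f x).ofLp)
            + 3 / 2 * ((n : ℝ) / s) * ((∇ f x).ofLp ⬝ᵥ (∇ f x).ofLp)) →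
      matNorm (hessMat f xbar) (x + rshtrDir P v t - xbar) ≤
        √(1 - 1 / (4 * condNumber (hessMat f xbar) * (√((n : ℝ) / s) + 1) ^ 2)) *
          matNorm (hessMat f xbar) (x - xbar) := by
  have : NeZero n := ⟨by omega⟩
  have hC := hf.contDiff
  set m := lambdaMin (hessMat f xbar) with hm_def
  set Λ := lambdaMax (hessMat f xbar) with hΛ_def
  have hm : 0 < m := lambdaMin_pos hpd
  have hlow : ∀ z : EuclideanSpace ℝ (Fin n), m * ‖z‖ ^ 2 ≤ inner ℝ z (hessOp f xbar z) := by
    intro z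
    have := lambdaMin_mul_le hpd.1 z.ofLp
    rwa [dotProduct_hessMat_mulVec, dotProduct_eq_inner, real_inner_self_eq_norm_sq] at this
  have hup : ∀ z : EuclideanSpace ℝ (Fin n), inner ℝ z (hessOp f xbar z) ≤ Λ * ‖z‖ ^ 2 := by
    intro z
    have := le_lambdaMax_mul hpd.1 z.ofLp
    rwa [dotProduct_hessMat_mulVec, dotProduct_eq_inner, real_inner_self_eq_norm_sq] at this
  have hΛ : 0 < Λ := by
    have h1 := (hlow (EuclideanSpace.single 0 1)).trans (hup _)
    simp only [PiLp.norm_single, norm_one, one_pow, mul_one] at h1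
    exact hm.trans_le h1
  set T : ℝ := 3 / 2 * ((n : ℝ) / s)
  have hT : 0 ≤ T := by positivity
  set S : ℝ := (√((n : ℝ) / s) + 1) ^ 2 with hS
  have hST : 1 / 2 + T < 2 * S := by
    have h1 := Real.sq_sqrt (show (0 : ℝ) ≤ (n : ℝ) / s by positivity)
    have h2 := Real.sqrt_nonneg ((n : ℝ) / s)
    simp only [hS, T]
    nlinarith
  have hS0 : 0 < S := by positivity
  set σ := 1 / (4 * Λ * S)
  have hσm : 1 / (4 * condNumber (hessMat f xbar) * S) = σ * m := by
    rw [condNumber, ← hm_def, ← hΛ_def]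
    simp only [σ]
    field_simp
  obtain ⟨ε, hε, hεm, hσ⟩ := exists_perturbation_radius (σ := σ) hm hΛ hT (by
    apply one_div_lt_one_div_of_lt (by positivity)
    nlinarith)
  obtain ⟨r, hr, hloc⟩ := gradient_local_bounds hC hf.hess_lipschitz hgrad hε
  refine ⟨r, hr, fun x hx P v t hsol hβ hγ => ?_⟩
  obtain ⟨h1, h2, h3⟩ := hloc x hx
  have hpert : ∀ z : EuclideanSpace ℝ (Fin n),
      |inner ℝ z (hessOp f x z) - inner ℝ z (hessOp f xbar z)| ≤ ε * ‖z‖ ^ 2 := by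
    intro z
    rw [← inner_sub_right, ← sub_apply]
    refine (abs_real_inner_le_norm _ _).trans ?_
    have := ContinuousLinearMap.le_of_opNorm_le _ h2 z
    nlinarith [norm_nonneg z]
  have hpsd : (hessMat f x).PosSemidef := by
    refine Matrix.PosSemidef.of_dotProduct_mulVec_nonneg (hessMat_isHermitian hC x) fun u => ?_
    have := dotProduct_hessMat_mulVec (f := f) x (WithLp.toLp 2 u) (WithLp.toLp 2 u)
    simp only at this
    rw [star_trivial, this]
    have h5 := (abs_le.1 (hpert (WithLp.toLp 2 u))).1
    have h6 := hlow (WithLp.toLp 2 u)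
    nlinarith [sq_nonneg ‖WithLp.toLp 2 u‖]
  rw [matNorm_hessMat, matNorm_hessMat, hσm]
  -- At `xbar` the subproblem has zero gradient, so `t` may vanish; positive definiteness then
  -- forces the step itself to be `0`.
  rcases eq_or_ne x xbar with rfl | hne
  · rw [hgrad] at hsol
    simp only [WithLp.ofLp_zero, Matrix.mulVec_zero] at hsol
    have h4 := hsol.rshtrDir_dotProduct_le_zero
    rw [dotProduct_hessMat_mulVec] at h4
    have h5 := (hlow _).trans h4
    have h6 : ‖rshtrDir P v t‖ = 0 := by
      by_contra h
      have : 0 < ‖rshtrDir P v t‖ ^ 2 := by positivity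
      nlinarith
    rw [norm_eq_zero.1 h6]
    simp
  set e := x - xbar with he
  have he0 : 0 < ‖e‖ := norm_pos_iff.2 (sub_ne_zero.2 hne)
  have hAe : m * ‖e‖ ≤ ‖hessOp f xbar e‖ := by
    have h1 := (hlow e).trans (real_inner_le_norm _ _)
    nlinarith
  have hg : ∇ f x ≠ 0 := by
    intro h0
    rw [h0, zero_sub, norm_neg] at h1
    nlinarith
  have hg0 : 0 < ‖∇ f x‖ := norm_pos_iff.2 hg
  rw [dotProduct_eq_inner, real_inner_self_eq_norm_sq] at hβ hγ
  have hb : P *ᵥ (∇ f x).ofLp ≠ 0 := by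
    intro h0
    rw [h0, dotProduct_zero] at hβ
    nlinarith [sq_pos_of_pos hg0]
  obtain ⟨θ, hθ, h4, h5, h6⟩ := hsol.rshtrDir_bounds hpsd hb
  rw [dotProduct_eq_inner] at h4
  rw [dotProduct_hessMat_mulVec] at h5
  have h7 : (Pᵀ *ᵥ (P *ᵥ (∇ f x).ofLp)) ⬝ᵥ hessMat f x *ᵥ (Pᵀ *ᵥ (P *ᵥ (∇ f x).ofLp))
      ≤ (Λ + ε) * ((Pᵀ *ᵥ (P *ᵥ (∇ f x).ofLp)) ⬝ᵥ (Pᵀ *ᵥ (P *ᵥ (∇ f x).ofLp))) := by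
    generalize Pᵀ *ᵥ (P *ᵥ (∇ f x).ofLp) = c
    have e1 := dotProduct_hessMat_mulVec (f := f) x (WithLp.toLp 2 c) (WithLp.toLp 2 c)
    have e2 := dotProduct_eq_inner (WithLp.toLp 2 c) (WithLp.toLp 2 c)
    simp only at e1 e2
    rw [e1, e2, real_inner_self_eq_norm_sq]
    have e3 := (abs_le.1 (hpert (WithLp.toLp 2 c))).2
    have e4 := hup (WithLp.toLp 2 c)
    linarith
  have h8 := inner_add_le_of_perturbation (inner_hessOp_comm hC xbar) hm hΛ hT hlow hε hεm
    (by positivity) hσ h1 h2 h3 hg hθ h4 h5 hβ hγ (h6.trans (by gcongr))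
  rw [add_sub_right_comm, ← he, ← Real.sqrt_mul']
  · exact Real.sqrt_le_sqrt h8
  · exact (by positivity : (0 : ℝ) ≤ m * ‖e‖ ^ 2).trans (hlow e)

end Contraction

/-! ### Adaptedness of the run and its passage to local mode. -/

section Run

theorem measurable_rshtrDir {Ω : Type*} [MeasurableSpace Ω] {s n : ℕ}
    {P : Ω → Matrix (Fin s) (Fin n) ℝ} {v : Ω → Fin s → ℝ} {t : Ω → ℝ}
    (hP : Measurable fun ω => matEntries (P ω)) (hv : Measurable v) (ht : Measurable t) :
    Measurable fun ω => rshtrDir (P ω) (v ω) (t ω) := by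
  have hPv : Measurable fun ω => (P ω)ᵀ *ᵥ v ω := by
    refine measurable_pi_lambda _ fun j => ?_
    simp only [Matrix.mulVec, dotProduct, Matrix.transpose_apply]
    refine Finset.measurable_fun_sum _ fun i _ => ?_
    exact ((measurable_pi_apply (i, j)).comp hP).mul ((measurable_pi_apply i).comp hv)
  unfold rshtrDir
  refine Measurable.ite (measurableSet_eq_fun ht measurable_const).compl ?_ ?_
  · exact (WithLp.measurable_toLp 2 _).comp (ht.inv.smul hPv)
  · exact (WithLp.measurable_toLp 2 _).comp hPv

theorem measurable_rshtrStep {Ω : Type*} [MeasurableSpace Ω] {n : ℕ} (Δ : ℝ) {b : Ω → Bool}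
    {x d : Ω → EuclideanSpace ℝ (Fin n)} (hb : Measurable b) (hx : Measurable x)
    (hd : Measurable d) : Measurable fun ω => rshtrStep Δ (b ω) (x ω) (d ω) := by
  unfold rshtrStep
  refine Measurable.ite ?_ (hx.add ((hd.norm.const_div Δ).smul hd)) (hx.add hd)
  exact (hb (measurableSet_singleton true)).inter (measurableSet_lt measurable_const hd.norm)

namespace IsRSHTRRun

variable {n s : ℕ} {f : EuclideanSpace ℝ (Fin n) → ℝ} {δ Δ : ℝ} {Ω : Type*}
  [mΩ : MeasurableSpace Ω] {μ : Measure Ω} {ℱ : Filtration ℕ mΩ}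
  {P : ℕ → Ω → Matrix (Fin s) (Fin n) ℝ} {v : ℕ → Ω → Fin s → ℝ} {t : ℕ → Ω → ℝ}
  {gm : ℕ → Ω → Bool} {x : ℕ → Ω → EuclideanSpace ℝ (Fin n)}

theorem measurable_dir (h : IsRSHTRRun f δ Δ μ ℱ P v t gm x) (k : ℕ) :
    Measurable[ℱ (k + 1)] fun ω => rshtrDir (P k ω) (v k ω) (t k ω) :=
  @measurable_rshtrDir Ω (ℱ (k + 1)) s n _ _ _ (h.measurable_mat k) (h.measurable_v k)
    (h.measurable_t k)

theorem measurable_mode_iterate (h : IsRSHTRRun f δ Δ μ ℱ P v t gm x) (k : ℕ) :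
    Measurable[ℱ k] (gm k) ∧ Measurable[ℱ k] (x k) := by
  induction k with
  | zero =>
    refine ⟨?_, h.measurable_init⟩
    rw [show gm 0 = fun _ => true from funext h.mode_zero]
    exact @measurable_const _ _ _ (ℱ 0) _
  | succ k ih =>
    have hle : ℱ k ≤ ℱ (k + 1) := ℱ.mono k.le_succ
    have h1 : Measurable[ℱ (k + 1)] (gm k) := ih.1.mono hle le_rfl
    have h2 : Measurable[ℱ (k + 1)] (x k) := ih.2.mono hle le_rfl
    have h3 := h.measurable_dir k
    constructor
    · refine @measurable_to_bool _ (ℱ (k + 1)) _ ?_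
      have : gm (k + 1) ⁻¹' {true} = gm k ⁻¹' {true} ∩
          {ω | Δ < ‖rshtrDir (P k ω) (v k ω) (t k ω)‖} := by
        ext ω
        exact h.mode_succ k ω
      rw [this]
      exact @MeasurableSet.inter _ (ℱ (k + 1)) _ _ (h1 (measurableSet_singleton true))
        ((continuous_norm.measurable.comp h3) (measurableSet_Ioi (a := Δ)))
    · rw [show x (k + 1) = _ from funext (h.step k)]
      exact @measurable_rshtrStep Ω (ℱ (k + 1)) n Δ _ _ _ h1 h2 h3

/-- Staying in global mode forever would make every step have length exactly `Δ`, against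
convergence; once left, the mode never returns. -/
theorem mode_eventually_false (h : IsRSHTRRun f δ Δ μ ℱ P v t gm x) (hΔ : 0 < Δ) {ω : Ω}
    {xbar : EuclideanSpace ℝ (Fin n)} (hx : Tendsto (fun k => x k ω) atTop (𝓝 xbar)) :
    ∀ᶠ k in atTop, gm k ω = false := by
  have hex : ∃ K, gm K ω = false := by
    by_contra! hall
    simp only [ne_eq, Bool.not_eq_false] at hall
    have hnorm : ∀ k, ‖x (k + 1) ω - x k ω‖ = Δ := by
      intro k
      have hlt := ((h.mode_succ k ω).1 (hall (k + 1))).2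
      have hpos := hΔ.trans hlt
      rw [h.step k ω, rshtrStep, if_pos ⟨hall k, hlt⟩, add_sub_cancel_left, norm_smul, norm_div,
        norm_norm, Real.norm_of_nonneg hΔ.le, div_mul_cancel₀ _ hpos.ne']
    have hlim := ((hx.comp (tendsto_add_atTop_nat 1)).sub hx).norm
    simp only [Function.comp_def, hnorm, sub_self, norm_zero] at hlim
    exact hΔ.ne' (tendsto_nhds_unique tendsto_const_nhds hlim)
  obtain ⟨K, hK⟩ := hex
  refine eventually_atTop.2 ⟨K, fun k hk => ?_⟩
  induction k, hk using Nat.le_induction with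
  | base => exact hK
  | succ k _ ih =>
    rw [← Bool.not_eq_true, h.mode_succ]
    simp [ih]

theorem tendsto_measure_not_local (h : IsRSHTRRun f δ Δ μ ℱ P v t gm x) [IsProbabilityMeasure μ]
    (hΔ : 0 < Δ) {xbar : EuclideanSpace ℝ (Fin n)}
    (hx : ∀ᵐ ω ∂μ, Tendsto (fun k => x k ω) atTop (𝓝 xbar)) {r : ℝ} (hr : 0 < r) :
    Tendsto (fun k => μ.real {ω | gm k ω = true ∨ r ≤ ‖x k ω - xbar‖}) atTop (𝓝 0) := by
  have key := tendsto_measure_of_ae_tendsto_indicator_of_isFiniteMeasure (μ := μ) atTop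
    (As := fun k => {ω | gm k ω = true ∨ r ≤ ‖x k ω - xbar‖}) (A := ∅) MeasurableSet.empty
    (fun k => ?_) ?_
  · rw [measure_empty] at key
    simpa [Measure.real, Function.comp_def] using (ENNReal.tendsto_toReal ENNReal.zero_ne_top).comp key
  · obtain ⟨h1, h2⟩ := h.measurable_mode_iterate k
    have h1' : Measurable (gm k) := h1.mono (ℱ.le k) le_rfl
    have h2' : Measurable (x k) := h2.mono (ℱ.le k) le_rfl
    exact (h1' (measurableSet_singleton true)).union
      (measurableSet_le measurable_const (h2'.sub_const _).norm)
  · filter_upwards [hx] with ω hω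
    have h2 := (tendsto_iff_norm_sub_tendsto_zero.1 hω).eventually (gt_mem_nhds hr)
    filter_upwards [h.mode_eventually_false hΔ hω, h2] with k hk hk'
    simp [hk, hk']

/-- Transfers bounds for a fixed vector to the random gradient, which is `ℱ k`-measurable and hence
independent of `P k`. The bound is not conditioned on the iterate being near `xbar`, since that
event is handled by a union bound. -/
theorem measure_matEntries_gradient_le (h : IsRSHTRRun f δ Δ μ ℱ P v t gm x)
    [IsProbabilityMeasure μ] (hf : ContDiff ℝ 2 f) (k : ℕ)
    {B : Set (Matrix (Fin s) (Fin n) ℝ × (Fin n → ℝ))} (hB : IsOpen B) {p : ℝ} (hp : 0 ≤ p)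
    (hBp : ∀ g, μ.real {ω | (P k ω, g) ∈ B} ≤ p) :
    μ.real {ω | (P k ω, (∇ f (x k ω)).ofLp) ∈ B} ≤ p := by
  have hg : Measurable[ℱ k] fun ω => (∇ f (x k ω)).ofLp :=
    (WithLp.measurable_ofLp 2 _).comp
      ((differentiable_gradient hf).continuous.measurable.comp (h.measurable_mode_iterate k).2)
  have hind : IndepFun (fun ω => matEntries (P k ω)) (fun ω => (∇ f (x k ω)).ofLp) μ :=
    indep_of_indep_of_le_right (h.indep_past k) hg.comap_le
  have hcont : Continuous fun z : (Fin s × Fin n → ℝ) × (Fin n → ℝ) =>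
      ((Matrix.of fun i j => z.1 (i, j) : Matrix (Fin s) (Fin n) ℝ), z.2) := by
    refine Continuous.prodMk (continuous_matrix fun i j => ?_) continuous_snd
    exact (continuous_apply (i, j)).comp continuous_fst
  exact measure_le_of_indepFun ((h.measurable_mat k).mono (ℱ.le _) le_rfl).aemeasurable
    (hg.mono (ℱ.le _) le_rfl).aemeasurable hind (hB.preimage hcont).measurableSet hp hBp

end IsRSHTRRun

end Run

/-! ### Union bound over the exceptional events. -/

theorem theorem3 :
    ∃ C 𝒞 : ℝ, 0 < C ∧ 0 < 𝒞 ∧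
      ∀ (n s : ℕ), 1 ≤ s → s ≤ n →
      ∀ (f : EuclideanSpace ℝ (Fin n) → ℝ) (L M : ℝ), HasLipschitzGradHess f L M →
      ∀ (δ Δ : ℝ), 0 ≤ δ → 0 < Δ →
      ∀ (Ω : Type*) [mΩ : MeasurableSpace Ω] (μ : Measure Ω) [IsProbabilityMeasure μ]
        (ℱ : Filtration ℕ mΩ) (P : ℕ → Ω → Matrix (Fin s) (Fin n) ℝ)
        (v : ℕ → Ω → Fin s → ℝ) (t : ℕ → Ω → ℝ) (gm : ℕ → Ω → Bool)
        (x : ℕ → Ω → EuclideanSpace ℝ (Fin n)),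
      IsRSHTRRun f δ Δ μ ℱ P v t gm x →
      ∀ xbar : EuclideanSpace ℝ (Fin n),
      ∇ f xbar = 0 → (hessMat f xbar).PosDef →
      (∀ᵐ ω ∂μ, Tendsto (fun k => x k ω) atTop (𝓝 xbar)) →
      ∃ k₀ : ℕ, ∀ k ≥ k₀,
        μ.real {ω | matNorm (hessMat f xbar) (x (k + 1) ω - xbar) ≤
            √(1 - 1 / (4 * condNumber (hessMat f xbar) * (√((n : ℝ) / s) + 𝒞) ^ 2)) *
              matNorm (hessMat f xbar) (x k ω - xbar)}
          ≥ 1 - 2 * Real.exp (-(C / 4) * s) - 8 * Real.exp (-(s : ℝ)) := by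
  -- `C / 4 = 1 / 40` is the chi-square rate; `𝒞 = 1` suffices for `1/2 + 3n/(2s) < 2(√(n/s) + 𝒞)²`.
  refine ⟨1 / 10, 1, by norm_num, one_pos, ?_⟩
  intro n s hs hsn f L M hf δ Δ _ hΔ Ω _ μ _ ℱ P v t gm x hrun xbar hgrad hpd hconv
  obtain ⟨r, hr, hstep⟩ := exists_radius_contraction hs hsn hf hgrad hpd
  have hslack : 0 < 8 * Real.exp (-(s : ℝ)) := by positivity
  obtain ⟨k₀, hk₀⟩ := eventually_atTop.1
    ((hrun.tendsto_measure_not_local hΔ hconv hr).eventually_le_const hslack)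
  refine ⟨k₀, fun k hk => ?_⟩
  have hlocal := hk₀ k hk
  have hlower := hrun.measure_matEntries_gradient_le hf.contDiff k
    (B := {z | (z.1 *ᵥ z.2) ⬝ᵥ (z.1 *ᵥ z.2) < 1 / 2 * (z.2 ⬝ᵥ z.2)})
    (isOpen_lt (by fun_prop) (by fun_prop)) (Real.exp_nonneg _)
    ((hrun.gaussian k).measure_mulVec_lt_le hs)
  have hupper := hrun.measure_matEntries_gradient_le hf.contDiff k
    (B := {z | ((z.1 *ᵥ z.2) ⬝ᵥ (z.1 *ᵥ z.2)) *
          ((z.1 *ᵥ z.2) ⬝ᵥ (z.1 *ᵥ z.2) + 3 / 2 * ((n : ℝ) / s) * (z.2 ⬝ᵥ z.2))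
        < (z.2 ⬝ᵥ z.2) * ((z.1ᵀ *ᵥ (z.1 *ᵥ z.2)) ⬝ᵥ (z.1ᵀ *ᵥ (z.1 *ᵥ z.2)))})
    (isOpen_lt (by fun_prop) (by fun_prop)) (Real.exp_nonneg _)
    ((hrun.gaussian k).measure_transpose_mulVec_mulVec_gt_le hs)
  have hexp : Real.exp (-(1 / 40) * (n : ℝ)) ≤ Real.exp (-(1 / 40) * (s : ℝ)) := by
    have : (s : ℝ) ≤ n := by exact_mod_cast hsn
    gcongr Real.exp ?_
    linarith
  have hC : Real.exp (-(1 / 10 / 4) * (s : ℝ)) = Real.exp (-(1 / 40) * (s : ℝ)) := by norm_num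
  set good := {ω | matNorm (hessMat f xbar) (x (k + 1) ω - xbar) ≤
    √(1 - 1 / (4 * condNumber (hessMat f xbar) * (√((n : ℝ) / s) + 1) ^ 2)) *
      matNorm (hessMat f xbar) (x k ω - xbar)}
  set far := {ω | gm k ω = true ∨ r ≤ ‖x k ω - xbar‖}
  set short := {ω | (P k ω, (∇ f (x k ω)).ofLp) ∈
    {z : Matrix (Fin s) (Fin n) ℝ × (Fin n → ℝ) |
      (z.1 *ᵥ z.2) ⬝ᵥ (z.1 *ᵥ z.2) < 1 / 2 * (z.2 ⬝ᵥ z.2)}}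
  set long := {ω | (P k ω, (∇ f (x k ω)).ofLp) ∈
    {z : Matrix (Fin s) (Fin n) ℝ × (Fin n → ℝ) | ((z.1 *ᵥ z.2) ⬝ᵥ (z.1 *ᵥ z.2)) *
          ((z.1 *ᵥ z.2) ⬝ᵥ (z.1 *ᵥ z.2) + 3 / 2 * ((n : ℝ) / s) * (z.2 ⬝ᵥ z.2))
        < (z.2 ⬝ᵥ z.2) * ((z.1ᵀ *ᵥ (z.1 *ᵥ z.2)) ⬝ᵥ (z.1ᵀ *ᵥ (z.1 *ᵥ z.2)))}}
  have hcover : Set.univ ⊆ good ∪ (far ∪ (short ∪ long)) := by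
    intro ω _
    by_contra hω
    simp only [Set.mem_union, not_or] at hω
    obtain ⟨hω1, hω2, hω3, hω4⟩ := hω
    simp only [far, Set.mem_ofPred_eq, not_or, Bool.not_eq_true, not_le] at hω2
    simp only [short, Set.mem_ofPred_eq, not_lt] at hω3
    simp only [long, Set.mem_ofPred_eq, not_lt] at hω4
    refine hω1 ?_
    have hsol := hrun.subproblem k ω
    simp only [hω2.1, Bool.false_eq_true, if_false] at hsol
    have := hstep (x k ω) hω2.2 (P k ω) (v k ω) (t k ω) hsol hω3 hω4
    simp only [good, Set.mem_ofPred_eq]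
    rw [hrun.step k ω, hω2.1, rshtrStep, if_neg (by simp)]
    exact this
  have hsum : 1 ≤ μ.real good + (μ.real far + (μ.real short + μ.real long)) := by
    calc (1 : ℝ) = μ.real Set.univ := by simp
      _ ≤ _ := (measureReal_mono hcover).trans ((measureReal_union_le _ _).trans (by
        gcongr
        refine (measureReal_union_le _ _).trans ?_
        gcongr
        exact measureReal_union_le _ _))
  rw [hC]
  linarith
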